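/- Let $P\subset\mathbb{R}^n$ be a lattice polytope (the convex hull of finitely many points of $\mathbb{Z}^n$) and let $c$ be a positive integer. A \emph{lattice triangulation} $\mathcal{T}$ of a lattice polytope $Q$ is a finite collection of simplices with vertices in $\mathbb{Z}^n$, closed under taking faces, any two meeting in a common (possibly empty) face, with union $Q$. It is \emph{unimodular} if each maximal simplex $\Delta$, of dimension $d$ say, is the image of $\operatorname{conv}\{0,e_1,\dots,e_d\}\subset\mathbb{R}^d$ under an injective affine map carrying $\mathbb{Z}^d$ onto $\mathbb{Z}^n\cap\operatorname{aff}(\Delta)$; \emph{regular} if there are weights $\omega\in\mathbb{R}^{Q\cap\mathbb{Z}^n}$ such that the nonempty simplices of $\mathcal{T}$ are exactly the nonempty sets of the form $\operatorname{conv}\{a\in Q\cap\mathbb{Z}^n:\omega_a=\langle\eta,a\rangle+\zeta\}$, where $\eta\in\mathbb{R}^n$, $\zeta\in\mathbb{R}$ satisfy $\omega_a\ge\langle\eta,a\rangle+\zeta$ for all $a\in Q\cap\mathbb{Z}^n$; \emph{flag} if every minimal set of vertices of $\mathcal{T}$ that is not the vertex set of a (possibly empty) simplex of $\mathcal{T}$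 has exactly two elements; and \emph{quadratic} if it is regular, unimodular and flag. For a simplex $\Delta=\operatorname{conv}\{a_0,\dots,a_d\}$ with ordered vertices $a_0,\dots,a_d$, consider the affine isomorphism $\operatorname{aff}(c\Delta)\to\operatorname{aff}(c\Delta_{\mathbf A}^d)$, $c\,a_i\mapsto c\sum_{j=1}^{i+1}e_j\in\mathbb{R}^{d+1}$, where $\Delta_{\mathbf A}^d=\operatorname{conv}\{\sum_{j=1}^{i+1}e_j:0\le i\le d\}$. The \emph{canonical triangulation} of $c\Delta$ is the pull-back under this map of the subdivision of $c\Delta_{\mathbf A}^d$ (including all its faces) obtained by slicing along all hyperplanes $z_i-z_j=k$ with $1\le i<j\le d+1$ and $k\in\mathbb{Z}$. \textbf{Theorem.} Let $\mathcal{T}$ be a lattice triangulation of $P$ and fix a total order on the vertices of $\mathcal{T}$, so that every $\Delta\in\mathcal{T}$ is an ordered simplex. Let $\mathcal{T}'$ be the union, over all nonempty $\Delta\in\mathcal{T}$, of the canonical triangulations of $c\Delta$. Then: \begin{enumerate} \item $\mathcal{T}'$ (together with the empty face) is a lattice triangulation of $cP$, and for every nonempty $\Delta\in\mathcal{T}$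 the nonempty simplices of $\mathcal{T}'$ contained in $c\Delta$ are exactly those of the canonical triangulation of $c\Delta$ (so common faces of different simplices of $c\mathcal{T}=\{c\Delta:\Delta\in\mathcal{T}\}$ get the same refinement); \item if $\mathcal{T}$ is unimodular, then $\mathcal{T}'$ is unimodular; \item if $\mathcal{T}$ is regular, then $\mathcal{T}'$ is regular; \item if $\mathcal{T}$ is flag, then $\mathcal{T}'$ is flag. \end{enumerate} In particular, if $P$ has a quadratic triangulation, then so does $cP$ for every positive integer $c$. -/

import Mathlib

open Geometry
open scoped Pointwise

namespace LatticeTriang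

/-- The lattice `ℤⁿ` inside `ℝⁿ`. -/
def latticePoints (n : ℕ) : Set (Fin n → ℝ) :=
  {x | ∀ i, ∃ k : ℤ, x i = (k : ℝ)}

/-- A lattice polytope: the convex hull of finitely many lattice points. -/
def IsLatticePolytope {n : ℕ} (P : Set (Fin n → ℝ)) : Prop :=
  ∃ V : Finset (Fin n → ℝ), (V : Set (Fin n → ℝ)) ⊆ latticePoints n ∧
    P = convexHull ℝ (V : Set (Fin n → ℝ))

/-- The polytopes (nonempty simplices) of a simplicial complex, as subsets of space. -/
def simplices {n : ℕ} (T : SimplicialComplex ℝ (Fin n → ℝ)) : Set (Set (Fin n → ℝ)) :=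
  (fun s : Finset (Fin n → ℝ) => convexHull ℝ (s : Set (Fin n → ℝ))) '' T.faces

/-- `T` is a lattice triangulation of `P`: a finite geometric simplicial complex with vertices
in the lattice and with union `P`. -/
structure IsLatticeTriangulation {n : ℕ} (T : SimplicialComplex ℝ (Fin n → ℝ))
    (P : Set (Fin n → ℝ)) : Prop where
  finite : T.faces.Finite
  vertices_subset : T.vertices ⊆ latticePoints n
  space_eq : T.space = P

/-- The standard simplex `conv {0, e₁, …, e_d}` in `ℝᵈ`. -/
def standardSimplex (d : ℕ) : Set (Fin d → ℝ) :=
  convexHull ℝ (insert 0 (Set.range fun i : Fin d => (Pi.single i 1 : Fin d → ℝ)))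

/-- A unimodular simplex: lattice equivalent to a standard simplex, that is, its image under an
injective affine map which carries `ℤᵈ` onto the lattice points of the affine hull. -/
def IsUnimodularSimplex {n : ℕ} (D : Set (Fin n → ℝ)) : Prop :=
  ∃ (d : ℕ) (f : (Fin d → ℝ) →ᵃ[ℝ] (Fin n → ℝ)), Function.Injective f ∧
    f '' latticePoints d = latticePoints n ∩ (affineSpan ℝ D : Set (Fin n → ℝ)) ∧
    f '' standardSimplex d = D

/-- Every cell (maximal simplex) is unimodular. -/
def IsUnimodular {n : ℕ} (T : SimplicialComplex ℝ (Fin n → ℝ)) : Prop :=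
  ∀ s ∈ T.facets, IsUnimodularSimplex (convexHull ℝ (s : Set (Fin n → ℝ)))

/-- The nonempty faces of the subdivision of `P` induced by the weights `w` on the lattice points
of `P`. Only the values of `w` on these points matter. -/
def regularSubdivision {n : ℕ} (P : Set (Fin n → ℝ)) (w : (Fin n → ℝ) → ℝ) :
    Set (Set (Fin n → ℝ)) :=
  {F | F.Nonempty ∧ ∃ (η : Fin n → ℝ) (ζ : ℝ),
    (∀ a ∈ P ∩ latticePoints n, η ⬝ᵥ a + ζ ≤ w a) ∧
    F = convexHull ℝ {a | a ∈ P ∩ latticePoints n ∧ w a = η ⬝ᵥ a + ζ}}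

/-- The triangulation `T` of `P` is regular. -/
def IsRegular {n : ℕ} (T : SimplicialComplex ℝ (Fin n → ℝ)) (P : Set (Fin n → ℝ)) : Prop :=
  ∃ w : (Fin n → ℝ) → ℝ, simplices T = regularSubdivision P w

/-- `T` is flag: every minimal non-face (a set of vertices of `T` which is not a face although
all its proper subsets are) has exactly two elements. The empty set counts as a face. -/
def IsFlag {n : ℕ} (T : SimplicialComplex ℝ (Fin n → ℝ)) : Prop :=
  ∀ N : Finset (Fin n → ℝ), N.Nonempty → (N : Set (Fin n → ℝ)) ⊆ T.vertices → N ∉ T.faces →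
    (∀ M : Finset (Fin n → ℝ), M ⊂ N → M.Nonempty → M ∈ T.faces) → N.card = 2

/-- `T` is a quadratic triangulation of `P`: a regular unimodular flag lattice triangulation. -/
structure IsQuadraticTriangulation {n : ℕ} (T : SimplicialComplex ℝ (Fin n → ℝ))
    (P : Set (Fin n → ℝ)) : Prop where
  triangulation : IsLatticeTriangulation T P
  regular : IsRegular T P
  unimodular : IsUnimodular T
  flag : IsFlag T

/-- The vertex `e₀ + ⋯ + eᵢ` of the standard simplex of type `A` in `ℝ^(d+1)`
(coordinates numbered from `0`). -/
def typeAVertex (d : ℕ) (i : Fin (d + 1)) : Fin (d + 1) → ℝ :=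
  ∑ j ∈ Finset.Iic i, Pi.single j 1

/-- The standard `d`-simplex of type `A`. -/
def typeASimplex (d : ℕ) : Set (Fin (d + 1) → ℝ) :=
  convexHull ℝ (Set.range (typeAVertex d))

/-- The type `A` dicing of `P`, where the facets of `P` lie on lattice root hyperplanes
`zᵢ - zⱼ = k`, `k ∈ ℤ`: all nonempty faces of the subdivision of `P` obtained by slicing along
all these hyperplanes. The face whose relative interior contains `y` is cut out by bounding each
`zᵢ - zⱼ` by the floor and the ceiling of `yᵢ - yⱼ`. -/
def typeADicing {d : ℕ} (P : Set (Fin (d + 1) → ℝ)) : Set (Set (Fin (d + 1) → ℝ)) :=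
  {C | ∃ y ∈ P, C = {z | z ∈ P ∧ ∀ i j : Fin (d + 1),
    (⌊y i - y j⌋ : ℝ) ≤ z i - z j ∧ z i - z j ≤ (⌈y i - y j⌉ : ℝ)}}

/-- The (type `A`) canonical triangulation of `c • Δ`, where `Δ` is the ordered simplex with
vertices `a 0, …, a d` (affinely independent): the type `A` dicing of `c • typeASimplex d`,
transported by the affine isomorphism between `c • typeASimplex d` and `c • Δ` that matches
`c • typeAVertex d i` with `c • a i`, that is, `∑ xᵢ • typeAVertex d i` with `∑ xᵢ • a i`. -/
def canonicalTriangulation {n d : ℕ} (c : ℕ) (a : Fin (d + 1) → Fin n → ℝ) :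
    Set (Set (Fin n → ℝ)) :=
  {C | ∃ D ∈ typeADicing ((c : ℝ) • typeASimplex d),
    C = {p | ∃ x : Fin (d + 1) → ℝ, ∑ i, x i • typeAVertex d i ∈ D ∧ ∑ i, x i • a i = p}}

/-- `a 0 < ⋯ < a d` is the list of the vertices of a simplex of `T`, increasing in the given
total order on the vertices of `T`. -/
def IsOrderedFace {n d : ℕ} (T : SimplicialComplex ℝ (Fin n → ℝ)) (ord : LinearOrder T.vertices)
    (a : Fin (d + 1) → T.vertices) : Prop :=
  (∀ i j, i < j → ord.lt (a i) (a j)) ∧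
    ∃ s ∈ T.faces, (s : Set (Fin n → ℝ)) = Set.range fun i => (a i : Fin n → ℝ)

/-- The union of the canonical triangulations of the dilations `c • Δ` of all simplices `Δ` of
`T`, each `Δ` being ordered by a given total order on the vertices of `T`. -/
def canonicalRefinement {n : ℕ} (T : SimplicialComplex ℝ (Fin n → ℝ))
    (ord : LinearOrder T.vertices) (c : ℕ) : Set (Set (Fin n → ℝ)) :=
  {C | ∃ (d : ℕ) (a : Fin (d + 1) → T.vertices), IsOrderedFace T ord a ∧
    C ∈ canonicalTriangulation c (fun i => (a i : Fin n → ℝ))}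

end LatticeTriang

open LatticeTriang

/-!
Let `V` be the ordered vertex set of `T`. A point of `c • T.space` has unique coordinates
`x : V → ℝ`, namely `c` times its barycentric coordinates, and the type `A` coordinates of all
faces are the sums of `x` over the upper sets of `V`. Slicing `V → ℝ` along the hyperplanes where
a difference of two upper sums is an integer therefore induces the canonical triangulation on
every dilated face at once, which is why the refinements agree on common faces.

* A cell of this arrangement is the convex hull of its integer points: rounding the upper sums of
  `x` down after a shift by `θ` gives integer points of the cell of `x` whose average over `θ`
  is `x`.
* The integer points of a cell are pairwise compatible: no difference of upper sums changes by more
  than `1`. Compatible integer vectors form a chain for the order of upper sums, so a difference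
  of two upper sums takes one value at a given vertex and that value minus `1` at all the others.
  This gives affine independence, and it makes the barycentric coordinates of integer points
  integers, hence unimodularity.
* Compatibility is a condition on pairs, hence flagness.
* For regularity, add to the weights defining `T` a small multiple of a convex function that is
  affine exactly on the cells: the sum over all differences of upper sums of the piecewise linear
  interpolation of `t ↦ t ^ 2` at the integers.
-/

namespace LatticeTriang

section AffineIndependence

variable {E : Type*} [AddCommGroup E] [Module ℝ E] {s : Finset E}

theorem affineIndependent_coe_finset
    (h : ∀ w : E → ℝ, ∑ v ∈ s, w v = 0 → ∑ v ∈ s, w v • v = 0 → ∀ v ∈ s, w v = 0) :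
    AffineIndependent ℝ ((↑) : s → E) := by
  rw [affineIndependent_iff_of_fintype]
  intro w hw_sum hw v
  rw [Finset.univ.weightedVSub_eq_linear_combination hw_sum] at hw
  have hext : ∀ u : s, Function.extend Subtype.val w 0 (u : E) = w u :=
    Subtype.val_injective.extend_apply w 0
  rw [← hext]
  refine h (Function.extend Subtype.val w 0) ?_ ?_ v v.2 <;> rw [← Finset.sum_coe_sort s] <;>
    simpa only [hext]

theorem exists_affineMap_eqOn (hs : AffineIndependent ℝ ((↑) : s → E)) (b : E → ℝ) :
    ∃ f : E →ᵃ[ℝ] ℝ, Set.EqOn f b s := by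
  classical
  obtain ⟨t, hst, ht, htop⟩ := exists_subset_affineIndependent_affineSpan_eq_top
    (s := (s : Set E)) hs
  let B : AffineBasis t ℝ E := ⟨(↑), ht, by rwa [Subtype.range_coe]⟩
  let φ : (t → ℝ) →ₗ[ℝ] ℝ := ∑ v : s, b v • LinearMap.proj ⟨v, hst v.2⟩
  refine ⟨φ.toAffineMap.comp B.coords, fun u hu => ?_⟩
  have hcoord : ∀ v : s, B.coord ⟨v, hst v.2⟩ u = if v = ⟨u, hu⟩ then 1 else 0 := fun v =>
    (B.coord_apply ⟨v, hst v.2⟩ ⟨u, hst hu⟩).trans (by simp [Subtype.ext_iff])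
  simp [φ, hcoord]

theorem subset_extremePoints_convexHull (hs : AffineIndependent ℝ ((↑) : s → E)) :
    (s : Set E) ⊆ (convexHull ℝ (s : Set E)).extremePoints ℝ := by
  classical
  refine fun v hv => ⟨subset_convexHull ℝ _ hv, ?_⟩
  rintro x hx y hy ⟨a, b, ha, hb, hab, hv_eq⟩
  obtain ⟨w, hw, hw_sum, rfl⟩ := Finset.mem_convexHull'.1 hx
  obtain ⟨u, hu, hu_sum, rfl⟩ := Finset.mem_convexHull'.1 hy
  have hweights : ∀ p ∈ s, a * w p + b * u p = if p = v then 1 else 0 := by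
    refine hs.eq_of_sum_eq_sum_subtype ?_ ?_
    · simp [Finset.sum_add_distrib, ← Finset.mul_sum, hw_sum, hu_sum, hab, Finset.mem_coe.1 hv]
    · simpa [add_smul, mul_smul, Finset.sum_add_distrib, ← Finset.smul_sum, ite_smul,
        Finset.mem_coe.1 hv] using hv_eq
  have hzero : ∀ p ∈ s, p ≠ v → w p = 0 := fun p hp hpv => by
    have := hweights p hp
    rw [if_neg hpv] at this
    nlinarith [hw p hp, mul_nonneg hb.le (hu p hp)]
  rw [Finset.sum_eq_single_of_mem v hv hzero] at hw_sum
  rw [Finset.sum_eq_single_of_mem v hv fun p hp hpv => by rw [hzero p hp hpv, zero_smul],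
    hw_sum, one_smul]

theorem coe_subset_of_convexHull_eq (hs : AffineIndependent ℝ ((↑) : s → E)) {A : Set E}
    (h : convexHull ℝ A = convexHull ℝ s) : (s : Set E) ⊆ A :=
  (subset_extremePoints_convexHull hs).trans (h ▸ extremePoints_convexHull_subset)

end AffineIndependence

section IntegerVectors

variable {ι : Type*}

/-- The subring of integers inside `ℝ`. -/
abbrev intReals : Subring ℝ := (Int.castRingHom ℝ).range

/-- A real vector with integer entries; on `Fin n` this is membership in `latticePoints n`, and
it is used for vectors indexed by the vertices of a triangulation as well. -/
def IsIntVector (x : ι → ℝ) : Prop := ∀ i, x i ∈ intReals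

theorem mem_latticePoints {n : ℕ} {x : Fin n → ℝ} : x ∈ latticePoints n ↔ IsIntVector x :=
  forall_congr' fun _ => exists_congr fun _ => eq_comm

theorem intCast_mem_intReals (k : ℤ) : (k : ℝ) ∈ intReals := ⟨k, rfl⟩

theorem add_one_le_of_lt_of_mem_intReals {s t : ℝ} (hs : s ∈ intReals) (ht : t ∈ intReals)
    (hst : s < t) : s + 1 ≤ t := by
  obtain ⟨k, rfl⟩ := hs
  obtain ⟨l, rfl⟩ := ht
  simp only [eq_intCast] at hst ⊢
  exact_mod_cast hst

theorem finite_setOf_isIntVector_of_mem_Icc [Finite ι] (l u : ι → ℝ) :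
    {x : ι → ℝ | IsIntVector x ∧ x ∈ Set.Icc l u}.Finite := by
  refine (Set.Finite.pi' fun i => (Set.finite_Icc ⌈l i⌉ ⌊u i⌋).image
    (fun k : ℤ => (k : ℝ))).subset ?_
  rintro x ⟨hx, hl, hu⟩ i
  obtain ⟨k, hk⟩ := hx i
  rw [eq_intCast] at hk
  exact ⟨k, ⟨Int.ceil_le.2 (hk ▸ hl i), Int.le_floor.2 (hk ▸ hu i)⟩, hk⟩

end IntegerVectors

section UpperSums

variable {V : Type*} [PartialOrder V] [Fintype V]

open Classical in
/-- The sums of the coordinates of a vector over the upper sets of its index set. For a simplex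
with ordered vertices, these are the type `A` coordinates of the point with barycentric
coordinates `x`. -/
noncomputable def upperSum : (V → ℝ) →ₗ[ℝ] (UpperSet V → ℝ) :=
  LinearMap.pi fun U => ∑ v with v ∈ U, LinearMap.proj v

open Classical in
theorem upperSum_apply (x : V → ℝ) (U : UpperSet V) : upperSum x U = ∑ v with v ∈ U, x v := by
  simp [upperSum]

@[simp]
theorem upperSum_top (x : V → ℝ) : upperSum x ⊤ = 0 := by
  simp [upperSum_apply]

@[simp]
theorem upperSum_bot (x : V → ℝ) : upperSum x ⊥ = ∑ v, x v := by
  simp [upperSum_apply]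

theorem IsIntVector.upperSum {x : V → ℝ} (hx : IsIntVector x) : IsIntVector (upperSum x) :=
  fun U => by
    rw [upperSum_apply]
    exact sum_mem fun v _ => hx v

/-- The difference of two upper sums, as a linear functional. The hyperplanes on which these
functionals are integers are the hyperplanes `zᵢ - zⱼ = k` of the type `A` dicing. -/
noncomputable def upperDiff (U W : UpperSet V) : (V → ℝ) →ₗ[ℝ] ℝ :=
  LinearMap.proj U ∘ₗ upperSum - LinearMap.proj W ∘ₗ upperSum

theorem upperDiff_apply (U W : UpperSet V) (x : V → ℝ) :
    upperDiff U W x = upperSum x U - upperSum x W := rfl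

theorem upperDiff_swap (U W : UpperSet V) (x : V → ℝ) : upperDiff W U x = -upperDiff U W x := by
  simp [upperDiff_apply]

@[simp]
theorem upperDiff_top (U : UpperSet V) (x : V → ℝ) : upperDiff U ⊤ x = upperSum x U := by
  simp [upperDiff_apply]

theorem upperDiff_Ici_Ioi (x : V → ℝ) (v : V) :
    upperDiff (UpperSet.Ici v) (UpperSet.Ioi v) x = x v := by
  classical
  have h : ({u | u ∈ UpperSet.Ici v} : Finset V) =
      insert v ({u | u ∈ UpperSet.Ioi v} : Finset V) := by
    ext u
    simp [le_iff_eq_or_lt, eq_comm]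
  rw [upperDiff_apply, upperSum_apply, upperSum_apply, h, Finset.sum_insert (by simp),
    add_sub_cancel_right]

theorem IsIntVector.upperDiff {x : V → ℝ} (hx : IsIntVector x) (U W : UpperSet V) :
    upperDiff U W x ∈ intReals :=
  sub_mem (hx.upperSum U) (hx.upperSum W)

theorem upperSum_injective : Function.Injective (upperSum : (V → ℝ) →ₗ[ℝ] _) := by
  intro x y h
  ext v
  rw [← upperDiff_Ici_Ioi x, ← upperDiff_Ici_Ioi y, upperDiff_apply, upperDiff_apply, h]

end UpperSums

section UpperSumInterpolation

variable {V : Type*} [LinearOrder V]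

theorem eq_top_or_exists_eq_Ici [Finite V] (U : UpperSet V) : U = ⊤ ∨ ∃ v, U = UpperSet.Ici v := by
  obtain hU | hU := (U : Set V).eq_empty_or_nonempty
  · exact Or.inl (UpperSet.ext hU)
  · obtain ⟨v, hvU, hv⟩ := (Set.toFinite (U : Set V)).exists_minimal hU
    refine Or.inr ⟨v, UpperSet.ext (Set.ext fun u => ⟨fun hu => ?_, fun hu => U.upper hu hvU⟩)⟩
    exact (le_total v u).elim id (hv hu)

variable [Fintype V]

theorem exists_upperSum_eq (G : UpperSet V → ℝ) :
    ∃ x : V → ℝ, ∀ U, upperSum x U = G U - G ⊤ := by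
  refine ⟨fun v => G (UpperSet.Ici v) - G (UpperSet.Ioi v), fun U => ?_⟩
  induction U using WellFoundedGT.induction with
  | ind U ih =>
    obtain rfl | ⟨v, rfl⟩ := eq_top_or_exists_eq_Ici U
    · simp
    · have hv := upperDiff_Ici_Ioi (fun v => G (UpperSet.Ici v) - G (UpperSet.Ioi v)) v
      rw [upperDiff_apply,
        ih (UpperSet.Ioi v) (UpperSet.coe_ssubset_coe.1 Set.Ioi_ssubset_Ici_self)] at hv
      linarith

end UpperSumInterpolation

section Cells

variable {V : Type*} [PartialOrder V] [Fintype V] {x y : V → ℝ}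

/-- The closed cell containing `x` in its relative interior, in the arrangement of all hyperplanes
`upperDiff U W = k` with `k ∈ ℤ`. The lower bounds are those of the swapped functionals. -/
def cell (x : V → ℝ) : Set (V → ℝ) :=
  {y | ∀ U W, upperDiff U W y ≤ ⌈upperDiff U W x⌉}

theorem mem_cell_self (x : V → ℝ) : x ∈ cell x := fun _ _ => Int.le_ceil _

theorem cell_subset_cell (h : y ∈ cell x) : cell y ⊆ cell x := fun _ hz U W =>
  (hz U W).trans (Int.cast_le.2 (Int.ceil_le.2 (h U W)))

theorem convex_cell (x : V → ℝ) : Convex ℝ (cell x) := by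
  simp only [cell, Set.ofPred_forall]
  exact convex_iInter₂ fun U W => convex_halfSpace_le (upperDiff U W).isLinear _

theorem floor_le_upperDiff_of_mem_cell (h : y ∈ cell x) (U W : UpperSet V) :
    ⌊upperDiff U W x⌋ ≤ upperDiff U W y := by
  have hWU := h W U
  rw [upperDiff_swap U W, upperDiff_swap U W, Int.ceil_neg, Int.cast_neg] at hWU
  exact neg_le_neg_iff.1 hWU

theorem mem_Icc_of_mem_cell (h : y ∈ cell x) :
    y ∈ Set.Icc (fun v => (⌊x v⌋ : ℝ)) (fun v => (⌈x v⌉ : ℝ)) := by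
  constructor <;> intro v
  · simpa only [upperDiff_Ici_Ioi] using
      floor_le_upperDiff_of_mem_cell h (UpperSet.Ici v) (UpperSet.Ioi v)
  · simpa only [upperDiff_Ici_Ioi] using h (UpperSet.Ici v) (UpperSet.Ioi v)

theorem nonneg_of_mem_cell (hx : 0 ≤ x) (h : y ∈ cell x) : 0 ≤ y := fun v =>
  (Int.cast_nonneg (Int.floor_nonneg.2 (hx v))).trans ((mem_Icc_of_mem_cell h).1 v)

theorem apply_eq_zero_of_mem_cell (h : y ∈ cell x) {v : V} (hv : x v = 0) : y v = 0 := by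
  have hy := mem_Icc_of_mem_cell h
  refine le_antisymm ((hy.2 v).trans_eq ?_) ((hy.1 v).trans_eq' ?_) <;> simp [hv]

theorem sum_eq_of_mem_cell {k : ℤ} (hx : ∑ v, x v = k) (h : y ∈ cell x) : ∑ v, y v = k := by
  have hle := h ⊥ ⊤
  have hge := floor_le_upperDiff_of_mem_cell h ⊥ ⊤
  simp only [upperDiff_top, upperSum_bot, hx, Int.floor_intCast, Int.ceil_intCast] at hle hge
  exact le_antisymm hle hge

/-- The integer points of the cell of `x`, which are its vertices. -/
def cellVertices (x : V → ℝ) : Set (V → ℝ) := {m | m ∈ cell x ∧ IsIntVector m}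

theorem cellVertices_subset_cellVertices (h : y ∈ cell x) : cellVertices y ⊆ cellVertices x :=
  fun _ hm => ⟨cell_subset_cell h hm.1, hm.2⟩

theorem finite_cellVertices (x : V → ℝ) : (cellVertices x).Finite :=
  (finite_setOf_isIntVector_of_mem_Icc _ _).subset fun _ hm => ⟨hm.2, mem_Icc_of_mem_cell hm.1⟩

end Cells

section CompatibleFamilies

variable {V : Type*} [PartialOrder V] [Fintype V] {x y m : V → ℝ}

/-- Two vectors on which every difference of upper sums takes values at distance at most `1`; for
integer vectors, no hyperplane of the arrangement separates them strictly. The relation is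
symmetric, since the two upper sets may be swapped. -/
def Compatible (x y : V → ℝ) : Prop := ∀ U W, upperDiff U W x ≤ upperDiff U W y + 1

theorem Compatible.upperSum_le_add_one (h : Compatible x y) (U : UpperSet V) :
    upperSum x U ≤ upperSum y U + 1 := by
  simpa using h U ⊤

theorem Compatible.upperSum_le_or_le (h : Compatible x y) (hx : IsIntVector x)
    (hy : IsIntVector y) : upperSum x ≤ upperSum y ∨ upperSum y ≤ upperSum x := by
  refine or_iff_not_imp_left.2 fun hxy U => ?_
  obtain ⟨W, hW⟩ := not_forall.1 hxy
  have hyx := add_one_le_of_lt_of_mem_intReals (hy.upperSum W) (hx.upperSum W) (not_le.1 hW)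
  have hWU := h W U
  rw [upperDiff_apply, upperDiff_apply] at hWU
  linarith

/-- A set of pairwise compatible integer vectors. The finite ones are the vertex sets of the
simplices of the arrangement. -/
structure IsCompatibleFamily (S : Set (V → ℝ)) : Prop where
  isIntVector : ∀ m ∈ S, IsIntVector m
  compatible : ∀ m ∈ S, ∀ m' ∈ S, Compatible m m'

theorem IsCompatibleFamily.mono {S S' : Set (V → ℝ)} (hS : IsCompatibleFamily S) (h : S' ⊆ S) :
    IsCompatibleFamily S' :=
  ⟨fun m hm => hS.isIntVector m (h hm), fun m hm m' hm' => hS.compatible m (h hm) m' (h hm')⟩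

theorem isCompatibleFamily_cellVertices (x : V → ℝ) : IsCompatibleFamily (cellVertices x) := by
  refine ⟨fun m hm => hm.2, fun m hm m' hm' U W => (hm.1 U W).trans ?_⟩
  have hceil : (⌈upperDiff U W x⌉ : ℝ) ≤ ⌊upperDiff U W x⌋ + 1 := by
    exact_mod_cast Int.ceil_le_floor_add_one _
  linarith [floor_le_upperDiff_of_mem_cell hm'.1 U W]

namespace IsCompatibleFamily

variable {S : Set (V → ℝ)}

theorem neg (hS : IsCompatibleFamily S) : IsCompatibleFamily (-S) := by
  refine ⟨fun m hm v => ?_, fun m hm m' hm' U W => ?_⟩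
  · simpa using neg_mem (hS.isIntVector _ hm v)
  · have h := hS.compatible _ hm' _ hm U W
    rw [map_neg, map_neg] at h
    linarith

theorem upperSum_le_or_lt (hS : IsCompatibleFamily S) (hx : x ∈ S) (hy : y ∈ S) :
    upperSum x ≤ upperSum y ∨ upperSum y < upperSum x :=
  or_iff_not_imp_left.2 fun h =>
    lt_of_le_not_ge (((hS.compatible x hx y hy).upperSum_le_or_le (hS.isIntVector x hx)
      (hS.isIntVector y hy)).resolve_left h) h

theorem exists_upperSum_add_one_eq (hS : IsCompatibleFamily S) (hx : x ∈ S) (hy : y ∈ S)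
    (hxy : upperSum x < upperSum y) : ∃ U, upperSum x U + 1 = upperSum y U := by
  obtain ⟨U, hU⟩ := (Pi.lt_def.1 hxy).2
  exact ⟨U, le_antisymm
    (add_one_le_of_lt_of_mem_intReals ((hS.isIntVector x hx).upperSum U)
      ((hS.isIntVector y hy).upperSum U) hU)
    ((hS.compatible y hy x hx).upperSum_le_add_one U)⟩

/- A compatible family is a chain for the order of upper sums. An upper sum that increases from
the predecessor of `m` to `m` is constant on the two parts into which `m` cuts the chain. -/
theorem exists_upperSum_eq_of_lt (hS : IsCompatibleFamily S) (hfin : S.Finite) (hm : m ∈ S) :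
    ∃ U, (∀ m' ∈ S, upperSum m' < upperSum m → upperSum m' U + 1 = upperSum m U) ∧
      ∀ m' ∈ S, upperSum m ≤ upperSum m' → upperSum m' U = upperSum m U := by
  obtain hbelow | hbelow := {m' ∈ S | upperSum m' < upperSum m}.eq_empty_or_nonempty
  · refine ⟨⊤, fun m' hm' hlt => ?_, by simp⟩
    exact absurd (show m' ∈ {m' ∈ S | upperSum m' < upperSum m} from ⟨hm', hlt⟩)
      (hbelow ▸ Set.notMem_empty m')
  obtain ⟨b, ⟨hb, hbm⟩, hmax⟩ :=
    (hfin.subset (Set.sep_subset S _)).exists_maximalFor upperSum _ hbelow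
  obtain ⟨U, hU⟩ := hS.exists_upperSum_add_one_eq hb hm hbm
  refine ⟨U, fun m' hm' hlt => ?_, fun m' hm' hle => ?_⟩
  · have hle : upperSum m' U ≤ upperSum b U :=
      (hS.upperSum_le_or_lt hm' hb).elim (· U) fun h => hmax ⟨hm', hlt⟩ h.le U
    linarith [(hS.compatible m hm m' hm').upperSum_le_add_one U]
  · linarith [hle U, (hS.compatible m' hm' b hb).upperSum_le_add_one U]

theorem exists_upperSum_eq_of_gt (hS : IsCompatibleFamily S) (hfin : S.Finite) (hm : m ∈ S) :
    ∃ U, (∀ m' ∈ S, upperSum m < upperSum m' → upperSum m' U = upperSum m U + 1) ∧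
      ∀ m' ∈ S, upperSum m' ≤ upperSum m → upperSum m' U = upperSum m U := by
  obtain ⟨U, hlt, hle⟩ := hS.neg.exists_upperSum_eq_of_lt hfin.neg (Set.neg_mem_neg.2 hm)
  refine ⟨U, fun m' hm' h => ?_, fun m' hm' h => ?_⟩
  · have := hlt (-m') (Set.neg_mem_neg.2 hm') (by simpa using h)
    simp only [map_neg, Pi.neg_apply] at this
    linarith
  · simpa using hle (-m') (Set.neg_mem_neg.2 hm') (by simpa using h)

theorem exists_upperDiff_facet (hS : IsCompatibleFamily S) (hfin : S.Finite) (hm : m ∈ S) :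
    ∃ U W, ∀ m' ∈ S, m' ≠ m → upperDiff U W m' = upperDiff U W m - 1 := by
  obtain ⟨U, hUlt, hUge⟩ := hS.exists_upperSum_eq_of_lt hfin hm
  obtain ⟨W, hWgt, hWle⟩ := hS.exists_upperSum_eq_of_gt hfin hm
  refine ⟨U, W, fun m' hm' hne => ?_⟩
  rw [upperDiff_apply, upperDiff_apply]
  obtain hle | hlt := hS.upperSum_le_or_lt hm' hm
  · linarith [hUlt m' hm' (lt_of_le_of_ne hle (upperSum_injective.ne hne)), hWle m' hm' hle]
  · linarith [hUge m' hm' hlt.le, hWgt m' hm' hlt]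

end IsCompatibleFamily

end CompatibleFamilies

section Coefficients

variable {V : Type*} [PartialOrder V] [Fintype V] {S : Finset (V → ℝ)} {m : V → ℝ}

theorem IsCompatibleFamily.exists_coefficient_eq (hS : IsCompatibleFamily (S : Set (V → ℝ)))
    (hm : m ∈ S) : ∃ U W, ∀ μ : (V → ℝ) → ℝ,
      μ m = upperDiff U W (∑ p ∈ S, μ p • p) - (upperDiff U W m - 1) * ∑ p ∈ S, μ p := by
  obtain ⟨U, W, hUW⟩ := hS.exists_upperDiff_facet S.finite_toSet hm
  refine ⟨U, W, fun μ => ?_⟩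
  rw [map_sum, Finset.mul_sum, ← Finset.sum_sub_distrib, Finset.sum_eq_single_of_mem m hm]
  · simp only [map_smul, smul_eq_mul]
    ring
  · intro p hp hpm
    simp only [map_smul, smul_eq_mul, hUW p hp hpm]
    ring

theorem IsCompatibleFamily.affineIndependent (hS : IsCompatibleFamily (S : Set (V → ℝ))) :
    AffineIndependent ℝ ((↑) : S → V → ℝ) := by
  refine affineIndependent_coe_finset fun w hw_sum hw m hm => ?_
  obtain ⟨U, W, hcoeff⟩ := hS.exists_coefficient_eq hm
  rw [hcoeff w, hw, hw_sum, map_zero, mul_zero, sub_zero]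

variable {μ : (V → ℝ) → ℝ}

theorem IsCompatibleFamily.mem_cell_of_pos (hS : IsCompatibleFamily (S : Set (V → ℝ)))
    (hμ : ∀ p ∈ S, 0 ≤ μ p) (hμ_sum : ∑ p ∈ S, μ p = 1) (hm : m ∈ S) (hpos : 0 < μ m) :
    m ∈ cell (∑ p ∈ S, μ p • p) := by
  intro U W
  suffices h : upperDiff U W m - 1 < upperDiff U W (∑ p ∈ S, μ p • p) by
    obtain ⟨k, hk⟩ := (hS.isIntVector m hm).upperDiff U W
    rw [← hk, eq_intCast] at h ⊢
    exact Int.cast_le.2 (Int.le_ceil_iff.2 h)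
  calc upperDiff U W m - 1 = ∑ p ∈ S, μ p * (upperDiff U W m - 1) := by
        rw [← Finset.sum_mul, hμ_sum, one_mul]
    _ < ∑ p ∈ S, μ p * upperDiff U W p :=
        Finset.sum_lt_sum
          (fun p hp => mul_le_mul_of_nonneg_left
            (sub_le_iff_le_add.2 (hS.compatible m hm p hp U W)) (hμ p hp))
          ⟨m, hm, mul_lt_mul_of_pos_left (sub_one_lt _) hpos⟩
    _ = upperDiff U W (∑ p ∈ S, μ p • p) := by simp only [map_sum, map_smul, smul_eq_mul]

theorem IsCompatibleFamily.pos_of_mem_cell (hS : IsCompatibleFamily (S : Set (V → ℝ)))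
    (hμ_sum : ∑ p ∈ S, μ p = 1) (hm : m ∈ S) (hcell : m ∈ cell (∑ p ∈ S, μ p • p)) :
    0 < μ m := by
  obtain ⟨U, W, hcoeff⟩ := hS.exists_coefficient_eq hm
  rw [hcoeff μ, hμ_sum]
  linarith [(hcell U W).trans_lt (Int.ceil_lt_add_one _)]

theorem IsCompatibleFamily.cellVertices_sum_of_pos
    (hS : IsCompatibleFamily (S : Set (V → ℝ))) (hμ : ∀ p ∈ S, 0 < μ p)
    (hμ_sum : ∑ p ∈ S, μ p = 1) : cellVertices (∑ p ∈ S, μ p • p) = S := by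
  classical
  have hsub : (S : Set (V → ℝ)) ⊆ cellVertices (∑ p ∈ S, μ p • p) := fun p hp =>
    ⟨hS.mem_cell_of_pos (fun q hq => (hμ q hq).le) hμ_sum hp (hμ p hp), hS.isIntVector p hp⟩
  refine Set.Subset.antisymm (fun m hm => by_contra fun hmS : m ∉ S => ?_) hsub
  have hins : IsCompatibleFamily (insert m S : Finset (V → ℝ)) :=
    (isCompatibleFamily_cellVertices (∑ p ∈ S, μ p • p)).mono <| by
      rw [Finset.coe_insert]
      exact Set.insert_subset hm hsub
  -- `m` has weight `0` in the combination, but the weight of a vertex of the cell is positive.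
  have hne : ∀ p ∈ S, Function.update μ m 0 p = μ p := fun p hp =>
    Function.update_of_ne (fun h : p = m => hmS (h ▸ hp)) _ _
  have hsum : ∑ p ∈ insert m S, Function.update μ m 0 p • p = ∑ p ∈ S, μ p • p := by
    rw [Finset.sum_insert hmS, Function.update_self, zero_smul, zero_add]
    exact Finset.sum_congr rfl fun p hp => by rw [hne p hp]
  have hpos : 0 < Function.update μ m 0 m := by
    refine hins.pos_of_mem_cell ?_ (Finset.mem_insert_self m S) (hsum ▸ hm.1)
    rw [Finset.sum_insert hmS, Function.update_self, zero_add, Finset.sum_congr rfl hne, hμ_sum]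
  simp at hpos

theorem IsCompatibleFamily.exists_cellVertices_eq (hS : IsCompatibleFamily (S : Set (V → ℝ)))
    (hne : S.Nonempty) : ∃ x ∈ convexHull ℝ (S : Set (V → ℝ)), cellVertices x = S := by
  have hcard : (0 : ℝ) < S.card := Nat.cast_pos.2 hne.card_pos
  have hsum : ∑ _p ∈ S, (S.card : ℝ)⁻¹ = 1 := by
    rw [Finset.sum_const, nsmul_eq_mul, mul_inv_cancel₀ hcard.ne']
  refine ⟨_, ?_, hS.cellVertices_sum_of_pos (fun _ _ => inv_pos.2 hcard) hsum⟩
  exact Finset.mem_convexHull'.2 ⟨_, fun _ _ => (inv_pos.2 hcard).le, hsum, rfl⟩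

end Coefficients

section CellVertices

open MeasureTheory

theorem intervalIntegrable_floor_add (z a b : ℝ) :
    IntervalIntegrable (fun θ => (⌊z + θ⌋ : ℝ)) volume a b := by
  refine Monotone.intervalIntegrable fun s t hst => ?_
  gcongr

theorem integral_fract_add (z : ℝ) :
    ∫ θ in (0 : ℝ)..1, Int.fract (z + θ) = ∫ θ in (0 : ℝ)..1, θ := by
  have hperiod := (Int.fract_periodic ℝ).intervalIntegral_add_eq z 0
  rw [zero_add] at hperiod
  rw [intervalIntegral.integral_comp_add_left (Int.fract ·) z, add_zero, hperiod]
  refine intervalIntegral.integral_congr_ae ?_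
  filter_upwards [Measure.ae_ne volume (1 : ℝ)] with θ hθ hmem
  rw [Set.uIoc_of_le zero_le_one] at hmem
  exact Int.fract_eq_self.2 ⟨hmem.1.le, lt_of_le_of_ne hmem.2 hθ⟩

theorem integral_floor_add (z : ℝ) : ∫ θ in (0 : ℝ)..1, (⌊z + θ⌋ : ℝ) = z := by
  have hlin : IntervalIntegrable (fun θ : ℝ => z + θ) volume 0 1 :=
    Continuous.intervalIntegrable (by fun_prop) _ _
  have hfract := integral_fract_add z
  simp only [Int.fract] at hfract
  rw [intervalIntegral.integral_sub hlin (intervalIntegrable_floor_add z 0 1),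
    intervalIntegral.integral_add (by simp) (by simp)] at hfract
  simp only [intervalIntegral.integral_const, sub_zero, one_smul] at hfract
  linarith

variable {V : Type*} [LinearOrder V] [Fintype V]

theorem exists_upperDiff_eq_floor (x : V → ℝ) (θ : ℝ) :
    ∃ r : V → ℝ, ∀ U W, upperDiff U W r = (⌊upperSum x U + θ⌋ : ℝ) - ⌊upperSum x W + θ⌋ := by
  obtain ⟨r, hr⟩ := exists_upperSum_eq fun U => (⌊upperSum x U + θ⌋ : ℝ)
  exact ⟨r, fun U W => by rw [upperDiff_apply, hr, hr, sub_sub_sub_cancel_right]⟩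

theorem mem_cellVertices_of_upperDiff_eq_floor {x r : V → ℝ} {θ : ℝ}
    (hr : ∀ U W, upperDiff U W r = (⌊upperSum x U + θ⌋ : ℝ) - ⌊upperSum x W + θ⌋) :
    r ∈ cellVertices x := by
  refine ⟨fun U W => ?_, fun v => ?_⟩
  · have hfloor : ⌊upperSum x U + θ⌋ ≤ ⌊upperSum x W + θ⌋ + ⌈upperDiff U W x⌉ := by
      rw [← Int.floor_add_intCast]
      refine Int.floor_le_floor ?_
      linarith [Int.le_ceil (upperDiff U W x), upperDiff_apply U W x]
    rw [hr, sub_le_iff_le_add']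
    exact_mod_cast hfloor
  · rw [← upperDiff_Ici_Ioi r, hr]
    exact sub_mem (intCast_mem_intReals _) (intCast_mem_intReals _)

/- Round the upper sums of `x` down after shifting them by `θ`. The resulting integer vectors lie
in the cell of `x`, and their average over `θ ∈ (0, 1]` is `x`. -/
theorem mem_convexHull_cellVertices (x : V → ℝ) : x ∈ convexHull ℝ (cellVertices x) := by
  choose r hr using exists_upperDiff_eq_floor x
  have hr_apply : ∀ v, (fun θ => r θ v) = fun θ =>
      (⌊upperSum x (UpperSet.Ici v) + θ⌋ : ℝ) - ⌊upperSum x (UpperSet.Ioi v) + θ⌋ := fun v =>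
    funext fun θ => by rw [← hr, upperDiff_Ici_Ioi]
  have hprob : IsProbabilityMeasure (volume.restrict (Set.Ioc (0 : ℝ) 1)) := ⟨by simp⟩
  have hint : Integrable r (volume.restrict (Set.Ioc (0 : ℝ) 1)) := by
    refine Integrable.of_eval fun v => ?_
    rw [hr_apply]
    exact (intervalIntegrable_iff_integrableOn_Ioc_of_le zero_le_one).1
      ((intervalIntegrable_floor_add _ 0 1).sub (intervalIntegrable_floor_add _ 0 1))
  have haverage : ∫ θ in Set.Ioc (0 : ℝ) 1, r θ = x := by
    ext v
    rw [eval_integral fun v => hint.eval v, ← intervalIntegral.integral_of_le zero_le_one,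
      hr_apply, intervalIntegral.integral_sub (intervalIntegrable_floor_add _ 0 1)
      (intervalIntegrable_floor_add _ 0 1), integral_floor_add, integral_floor_add,
      ← upperDiff_apply, upperDiff_Ici_Ioi]
  rw [← haverage]
  exact (convex_convexHull ℝ _).integral_mem
    ((finite_cellVertices _).isCompact_convexHull (𝕜 := ℝ)).isClosed
    (.of_forall fun θ => subset_convexHull ℝ _ <| by
      rw [haverage]
      exact mem_cellVertices_of_upperDiff_eq_floor (hr θ)) hint

theorem convexHull_cellVertices (x : V → ℝ) : convexHull ℝ (cellVertices x) = cell x :=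
  Set.Subset.antisymm (convexHull_min (fun _ hm => hm.1) (convex_cell x)) fun y hy =>
    convexHull_mono (cellVertices_subset_cellVertices hy) (mem_convexHull_cellVertices y)

theorem cellVertices_nonempty (x : V → ℝ) : (cellVertices x).Nonempty :=
  convexHull_nonempty_iff.1 ⟨x, mem_convexHull_cellVertices x⟩

end CellVertices

section Realization

variable {E : Type*} [AddCommGroup E] [Module ℝ E] {T : SimplicialComplex ℝ E}
  {V : Type*} (e : V ≃ T.vertices) {c : ℕ} {σ τ : Finset E} {x y : V → ℝ}

theorem coe_subset_vertices (hσ : σ ∈ T.faces) : (σ : Set E) ⊆ T.vertices := fun p hp =>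
  T.down_closed hσ (Finset.singleton_subset_iff.2 hp) (Finset.singleton_nonempty p)

theorem exists_label (hσ : σ ∈ T.faces) {p : E} (hp : p ∈ σ) :
    ∃ v, (e v : E) = p :=
  ⟨e.symm ⟨p, coe_subset_vertices hσ hp⟩, by simp⟩

variable [Fintype V]

/-- The point with given coordinates with respect to the vertices of `T`, labelled by `V`. -/
noncomputable def realize : (V → ℝ) →ₗ[ℝ] E :=
  Fintype.linearCombination ℝ fun v => (e v : E)

theorem realize_apply (x : V → ℝ) : realize e x = ∑ v, x v • (e v : E) :=
  Fintype.linearCombination_apply ..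

/-- The coordinates of the points of the dilation `c • conv σ` of a face `σ`: barycentric
coordinates multiplied by `c`. -/
def dilatedFace (c : ℕ) (σ : Finset E) : Set (V → ℝ) :=
  {x | 0 ≤ x ∧ ∑ v, x v = c ∧ ∀ v, (e v : E) ∉ σ → x v = 0}

theorem convex_dilatedFace (c : ℕ) (σ : Finset E) : Convex ℝ (dilatedFace e c σ) := by
  rintro x ⟨hx, hx_sum, hxσ⟩ y ⟨hy, hy_sum, hyσ⟩ a b ha hb hab
  refine ⟨add_nonneg (smul_nonneg ha hx) (smul_nonneg hb hy), ?_, fun v hv => ?_⟩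
  · simp [Finset.sum_add_distrib, ← Finset.mul_sum, hx_sum, hy_sum, ← add_mul, hab]
  · simp [hxσ v hv, hyσ v hv]

variable {e}

theorem dilatedFace_mono (h : σ ⊆ τ) : dilatedFace e c σ ⊆ dilatedFace e c τ :=
  fun _ hx => ⟨hx.1, hx.2.1, fun v hv => hx.2.2 v fun hvσ => hv (h hvσ)⟩

theorem sum_labels_eq_sum_face {M : Type*} [AddCommMonoid M] (hσ : σ ∈ T.faces) {F : E → M}
    (hF : ∀ v, (e v : E) ∉ σ → F (e v) = 0) : ∑ v, F (e v) = ∑ p ∈ σ, F p := by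
  have hinj : Function.Injective fun v => (e v : E) := Subtype.val_injective.comp e.injective
  rw [← Finset.sum_preimage _ σ hinj.injOn F fun p hp hrange =>
    absurd (exists_label e hσ hp) hrange]
  exact (Finset.sum_subset (Finset.subset_univ _) fun v _ hv =>
    hF v fun hvσ => hv (Finset.mem_preimage.2 hvσ)).symm

theorem exists_weights (hσ : σ ∈ T.faces) (hx : ∀ v, (e v : E) ∉ σ → x v = 0) :
    ∃ w : E → ℝ, (∀ v, w (e v) = x v) ∧ ∑ p ∈ σ, w p = ∑ v, x v ∧
      ∑ p ∈ σ, w p • p = realize e x := by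
  have hinj : Function.Injective fun v => (e v : E) := Subtype.val_injective.comp e.injective
  have hext := hinj.extend_apply x 0
  set w := Function.extend (fun v => (e v : E)) x 0
  refine ⟨w, hext, ?_, ?_⟩
  · rw [← sum_labels_eq_sum_face (e := e) hσ fun v hv => by rw [hext, hx v hv]]
    simp only [hext]
  · rw [← sum_labels_eq_sum_face (e := e) hσ fun v hv => by rw [hext, hx v hv, zero_smul],
      realize_apply]
    simp only [hext]

theorem eq_of_realize_eq (hσ : σ ∈ T.faces) (hx : ∀ v, (e v : E) ∉ σ → x v = 0)
    (hy : ∀ v, (e v : E) ∉ σ → y v = 0) (hsum : ∑ v, x v = ∑ v, y v)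
    (h : realize e x = realize e y) : x = y := by
  have hxy : ∀ v, (e v : E) ∉ σ → (x - y) v = 0 := fun v hv => by simp [hx v hv, hy v hv]
  obtain ⟨w, hw, hw_sum, hw_realize⟩ := exists_weights hσ hxy
  have hw_zero : ∀ p ∈ σ, w p = 0 :=
    (T.indep hσ).eq_zero_of_sum_eq_zero_subtype (by simp [hw_sum, hsum])
      (by rw [hw_realize, map_sub, h, sub_self])
  ext v
  by_cases hv : (e v : E) ∈ σ
  · exact sub_eq_zero.1 ((hw v).symm.trans (hw_zero _ hv))
  · rw [hx v hv, hy v hv]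

theorem exists_mem_dilatedFace (hσ : σ ∈ T.faces) {w : E → ℝ} (hw : ∀ p ∈ σ, 0 ≤ w p)
    (hw_sum : ∑ p ∈ σ, w p = c) :
    ∃ x ∈ dilatedFace e c σ, realize e x = ∑ p ∈ σ, w p • p := by
  classical
  let w' : E → ℝ := fun p => if p ∈ σ then w p else 0
  have hw'_eq : ∀ p ∈ σ, w' p = w p := fun p hp => if_pos hp
  have hw'_zero : ∀ p ∉ σ, w' p = 0 := fun p hp => if_neg hp
  refine ⟨fun v => w' (e v), ⟨fun v => ?_, ?_, fun v hv => hw'_zero _ hv⟩, ?_⟩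
  · by_cases hv : (e v : E) ∈ σ
    · exact (hw _ hv).trans_eq (hw'_eq _ hv).symm
    · exact (hw'_zero _ hv).ge
  · rw [sum_labels_eq_sum_face (F := w') hσ fun v hv => hw'_zero _ hv,
      Finset.sum_congr rfl hw'_eq, hw_sum]
  · rw [realize_apply, sum_labels_eq_sum_face (F := fun p => w' p • p) hσ fun v hv => by
      rw [hw'_zero _ hv, zero_smul]]
    exact Finset.sum_congr rfl fun p hp => by rw [hw'_eq p hp]

theorem image_realize_dilatedFace [NeZero c] (hσ : σ ∈ T.faces) :
    realize e '' dilatedFace e c σ = (c : ℝ) • convexHull ℝ (σ : Set E) := by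
  have hc : (c : ℝ) ≠ 0 := NeZero.ne _
  refine Set.Subset.antisymm ?_ ?_
  · rintro _ ⟨x, ⟨hx, hx_sum, hxσ⟩, rfl⟩
    obtain ⟨w, hw, hw_sum, hw_realize⟩ := exists_weights hσ hxσ
    refine (Set.mem_smul_set_iff_inv_smul_mem₀ hc _ _).2 <|
      Finset.mem_convexHull'.2 ⟨fun p => (c : ℝ)⁻¹ * w p, fun p hp => ?_, ?_, ?_⟩
    · obtain ⟨v, rfl⟩ := exists_label e hσ hp
      exact mul_nonneg (by positivity) (hw v ▸ hx v)
    · rw [← Finset.mul_sum, hw_sum, hx_sum, inv_mul_cancel₀ hc]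
    · simp only [mul_smul, ← Finset.smul_sum, hw_realize]
  · rintro _ ⟨_, hq, rfl⟩
    obtain ⟨w, hw, hw_sum, rfl⟩ := Finset.mem_convexHull'.1 hq
    obtain ⟨x, hx, hx_realize⟩ := exists_mem_dilatedFace (e := e) (c := c) (w := fun p => c * w p)
      hσ (fun p hp => mul_nonneg (Nat.cast_nonneg c) (hw p hp))
      (by rw [← Finset.mul_sum, hw_sum, mul_one])
    exact ⟨x, hx, by simp only [hx_realize, mul_smul, Finset.smul_sum]⟩

/-- The coordinates of the points of `c • T.space`. -/
def dilatedComplex (e : V ≃ T.vertices) (c : ℕ) : Set (V → ℝ) :=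
  ⋃ σ ∈ T.faces, dilatedFace e c σ

theorem mem_dilatedComplex : x ∈ dilatedComplex e c ↔ ∃ σ ∈ T.faces, x ∈ dilatedFace e c σ := by
  simp [dilatedComplex]

theorem image_realize_dilatedComplex [NeZero c] :
    realize e '' dilatedComplex e c = (c : ℝ) • T.space := by
  rw [dilatedComplex, Set.image_iUnion₂, SimplicialComplex.space, Set.smul_set_iUnion₂]
  exact Set.iUnion₂_congr fun σ hσ => image_realize_dilatedFace hσ

theorem injOn_realize_dilatedFace (hσ : σ ∈ T.faces) :
    Set.InjOn (realize e) (dilatedFace e c σ) := fun _ hx _ hy h =>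
  eq_of_realize_eq hσ hx.2.2 hy.2.2 (hx.2.1.trans hy.2.1.symm) h

theorem injOn_realize_dilatedComplex [NeZero c] :
    Set.InjOn (realize e) (dilatedComplex e c) := by
  classical
  intro x hx y hy h
  obtain ⟨σ, hσ, hxσ⟩ := mem_dilatedComplex.1 hx
  obtain ⟨τ, hτ, hyτ⟩ := mem_dilatedComplex.1 hy
  have hc : (c : ℝ) ≠ 0 := NeZero.ne _
  have hinter : realize e x ∈ (c : ℝ) • convexHull ℝ ((σ ∩ τ : Finset E) : Set E) := by
    have hmem_σ := image_realize_dilatedFace (e := e) (c := c) hσ ▸ Set.mem_image_of_mem _ hxσ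
    have hmem_τ := image_realize_dilatedFace (e := e) (c := c) hτ ▸ Set.mem_image_of_mem _ hyτ
    rw [Set.mem_smul_set_iff_inv_smul_mem₀ hc] at hmem_σ hmem_τ ⊢
    rw [Finset.coe_inter]
    exact T.inter_subset_convexHull hσ hτ ⟨hmem_σ, h ▸ hmem_τ⟩
  have hne : (σ ∩ τ).Nonempty := by
    obtain ⟨q, hq, -⟩ := hinter
    exact Finset.coe_nonempty.1 (convexHull_nonempty_iff.1 ⟨q, hq⟩)
  rw [← image_realize_dilatedFace (e := e) (T.down_closed hσ Finset.inter_subset_left hne)]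
    at hinter
  obtain ⟨z, hz, hzx⟩ := hinter
  exact (injOn_realize_dilatedFace hσ (dilatedFace_mono Finset.inter_subset_left hz) hxσ hzx).symm
    |>.trans (injOn_realize_dilatedFace hτ (dilatedFace_mono Finset.inter_subset_right hz) hyτ
      (hzx.trans h))

theorem mem_dilatedFace_of_realize_mem [NeZero c] (hσ : σ ∈ T.faces)
    (hx : x ∈ dilatedComplex e c) (h : realize e x ∈ (c : ℝ) • convexHull ℝ (σ : Set E)) :
    x ∈ dilatedFace e c σ := by
  rw [← image_realize_dilatedFace (e := e) hσ] at h
  obtain ⟨y, hy, hyx⟩ := h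
  exact injOn_realize_dilatedComplex (mem_dilatedComplex.2 ⟨σ, hσ, hy⟩) hx hyx ▸ hy

theorem sum_smul_apply_eq_zero {S : Finset (V → ℝ)}
    (hSσ : (S : Set (V → ℝ)) ⊆ dilatedFace e c σ) (w : (V → ℝ) → ℝ) {v : V}
    (hv : (e v : E) ∉ σ) : (∑ m ∈ S, w m • m) v = 0 := by
  rw [Finset.sum_apply]
  exact Finset.sum_eq_zero fun m hm => by simp [(hSσ hm).2.2 v hv]

theorem sum_sum_smul_apply {S : Finset (V → ℝ)}
    (hSσ : (S : Set (V → ℝ)) ⊆ dilatedFace e c σ) (w : (V → ℝ) → ℝ) :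
    ∑ v, (∑ m ∈ S, w m • m) v = (∑ m ∈ S, w m) * c := by
  simp only [Finset.sum_apply, Pi.smul_apply, smul_eq_mul]
  rw [Finset.sum_comm, Finset.sum_mul]
  exact Finset.sum_congr rfl fun m hm => by rw [← Finset.mul_sum, (hSσ hm).2.1]

end Realization

section Refinement

theorem sum_eq_sum_of_coe_eq_image {α β M : Type*} [AddCommMonoid M] {f : α → β} {s : Finset α}
    {t : Finset β} (hf : Set.InjOn f s) (ht : (t : Set β) = f '' s) (F : β → M) :
    ∑ p ∈ t, F p = ∑ m ∈ s, F (f m) :=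
  (Finset.sum_nbij f (fun _ hm => Finset.mem_coe.1 (ht ▸ Set.mem_image_of_mem f hm)) hf
    (fun _ hp => ht ▸ hp) fun _ _ => rfl).symm

variable {E : Type*} [AddCommGroup E] [Module ℝ E] {T : SimplicialComplex ℝ E}
  {V : Type*} [LinearOrder V] [Fintype V] {e : V ≃ T.vertices} {c : ℕ} {σ t : Finset E}
  {x : V → ℝ} {S : Finset (V → ℝ)}

theorem cell_subset_dilatedFace (hx : x ∈ dilatedFace e c σ) : cell x ⊆ dilatedFace e c σ :=
  fun _ hy => ⟨nonneg_of_mem_cell hx.1 hy, sum_eq_of_mem_cell (k := c) hx.2.1 hy,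
    fun v hv => apply_eq_zero_of_mem_cell hy (hx.2.2 v hv)⟩

theorem cell_subset_dilatedComplex (hx : x ∈ dilatedComplex e c) :
    cell x ⊆ dilatedComplex e c := by
  obtain ⟨σ, hσ, hxσ⟩ := mem_dilatedComplex.1 hx
  exact fun y hy => mem_dilatedComplex.2 ⟨σ, hσ, cell_subset_dilatedFace hxσ hy⟩

theorem IsCompatibleFamily.affineIndependent_image (hS : IsCompatibleFamily (S : Set (V → ℝ)))
    (hσ : σ ∈ T.faces) (hSσ : (S : Set (V → ℝ)) ⊆ dilatedFace e c σ)
    (ht : (t : Set E) = realize e '' S) : AffineIndependent ℝ ((↑) : t → E) := by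
  have hinj := (injOn_realize_dilatedFace hσ).mono hSσ
  refine affineIndependent_coe_finset fun w hw_sum hw p hp => ?_
  rw [sum_eq_sum_of_coe_eq_image hinj ht] at hw_sum hw
  have hzero : ∑ m ∈ S, w (realize e m) • m = 0 := by
    refine eq_of_realize_eq (e := e) hσ (fun v hv => sum_smul_apply_eq_zero hSσ _ hv)
      (fun _ _ => rfl) ?_ ?_
    · rw [sum_sum_smul_apply hSσ, hw_sum]
      simp
    · simpa only [map_sum, map_smul, map_zero] using hw
  obtain ⟨m, hm, rfl⟩ := ht ▸ Finset.mem_coe.2 hp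
  exact hS.affineIndependent.eq_zero_of_sum_eq_zero_subtype hw_sum hzero m hm

theorem convexHull_eq_image_cell (ht : (t : Set E) = realize e '' cellVertices x) :
    convexHull ℝ (t : Set E) = realize e '' cell x := by
  rw [ht, ← LinearMap.image_convexHull, convexHull_cellVertices]

/-- The canonical refinement of the `c`-fold dilation of `T`: its simplices are the realizations
of the cells of the points of the dilated complex. -/
noncomputable def refinedComplex (e : V ≃ T.vertices) (c : ℕ) [NeZero c] :
    SimplicialComplex ℝ E where
  faces := {t | ∃ x ∈ dilatedComplex e c, (t : Set E) = realize e '' cellVertices x}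
  isRelLowerSet_faces := by
    rintro t ⟨x, hx, ht⟩
    refine ⟨Finset.coe_nonempty.1 (ht ▸ (cellVertices_nonempty x).image _), fun u hut hu => ?_⟩
    obtain ⟨S, hSx, hS⟩ := Set.subset_image_iff.1 ((Finset.coe_subset.2 hut).trans_eq ht)
    lift S to Finset (V → ℝ) using (finite_cellVertices x).subset hSx
    have hne : S.Nonempty := by
      rwa [← Finset.coe_nonempty, ← hS, Set.image_nonempty, Finset.coe_nonempty] at hu
    obtain ⟨y, hy, hyS⟩ := ((isCompatibleFamily_cellVertices x).mono hSx).exists_cellVertices_eq hne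
    have hyx : y ∈ cell x := convexHull_cellVertices x ▸ convexHull_mono hSx hy
    exact ⟨y, cell_subset_dilatedComplex hx hyx, by rw [hyS, hS]⟩
  indep := by
    rintro t ⟨x, hx, ht⟩
    obtain ⟨σ, hσ, hxσ⟩ := mem_dilatedComplex.1 hx
    rw [← (finite_cellVertices x).coe_toFinset] at ht
    refine IsCompatibleFamily.affineIndependent_image (c := c) ?_ hσ ?_ ht <;>
      rw [(finite_cellVertices x).coe_toFinset]
    · exact isCompatibleFamily_cellVertices x
    · exact fun m hm => cell_subset_dilatedFace hxσ hm.1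
  inter_subset_convexHull := by
    rintro t t' ⟨x, hx, ht⟩ ⟨x', hx', ht'⟩ p ⟨hp, hp'⟩
    rw [convexHull_eq_image_cell ht] at hp
    rw [convexHull_eq_image_cell ht'] at hp'
    obtain ⟨y, hy, rfl⟩ := hp
    obtain ⟨y', hy', h⟩ := hp'
    obtain rfl := injOn_realize_dilatedComplex (cell_subset_dilatedComplex hx' hy')
      (cell_subset_dilatedComplex hx hy) h
    have hmem := Set.mem_image_of_mem (realize e) (mem_convexHull_cellVertices y')
    rw [LinearMap.image_convexHull] at hmem
    refine convexHull_mono (Set.subset_inter ?_ ?_) hmem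
    · exact ht ▸ Set.image_mono (cellVertices_subset_cellVertices hy)
    · exact ht' ▸ Set.image_mono (cellVertices_subset_cellVertices hy')

variable [NeZero c]

theorem IsCompatibleFamily.mem_faces_refinedComplex
    (hS : IsCompatibleFamily (S : Set (V → ℝ))) (hne : S.Nonempty) (hσ : σ ∈ T.faces)
    (hSσ : (S : Set (V → ℝ)) ⊆ dilatedFace e c σ) (ht : (t : Set E) = realize e '' S) :
    t ∈ (refinedComplex e c).faces := by
  obtain ⟨x, hx, hxS⟩ := hS.exists_cellVertices_eq hne
  exact ⟨x, mem_dilatedComplex.2 ⟨σ, hσ, convexHull_min hSσ (convex_dilatedFace e c σ) hx⟩,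
    hxS.symm ▸ ht⟩

theorem exists_mem_faces_refinedComplex (hx : x ∈ dilatedComplex e c) :
    ∃ t ∈ (refinedComplex e c).faces, (t : Set E) = realize e '' cellVertices x :=
  have ht := ((finite_cellVertices x).image (realize e)).coe_toFinset
  ⟨_, ⟨x, hx, ht⟩, ht⟩

theorem space_refinedComplex : (refinedComplex e c).space = (c : ℝ) • T.space := by
  rw [← image_realize_dilatedComplex (e := e)]
  ext p
  rw [SimplicialComplex.mem_space_iff]
  constructor
  · rintro ⟨t, ⟨x, hx, ht⟩, hp⟩
    rw [convexHull_eq_image_cell ht] at hp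
    exact Set.image_mono (cell_subset_dilatedComplex hx) hp
  · rintro ⟨x, hx, rfl⟩
    obtain ⟨t, ht_mem, ht⟩ := exists_mem_faces_refinedComplex hx
    exact ⟨t, ht_mem, convexHull_eq_image_cell ht ▸ Set.mem_image_of_mem _ (mem_cell_self x)⟩

theorem finite_faces_refinedComplex : (refinedComplex e c).faces.Finite := by
  refine Set.Finite.of_finite_image (f := fun t => (t : Set E)) ?_ Finset.coe_injective.injOn
  have hfin := finite_setOf_isIntVector_of_mem_Icc (0 : V → ℝ) fun _ => (c : ℝ)
  refine (hfin.image (realize e)).finite_subsets.subset ?_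
  rintro _ ⟨t, ⟨x, hx, ht⟩, rfl⟩
  obtain ⟨σ, -, hxσ⟩ := mem_dilatedComplex.1 hx
  refine ht.trans_subset (Set.image_mono fun m hm => ?_)
  obtain ⟨hm_nonneg, hm_sum, -⟩ := cell_subset_dilatedFace hxσ hm.1
  exact ⟨hm.2, hm_nonneg, fun v =>
    hm_sum ▸ Finset.single_le_sum (fun u _ => hm_nonneg u) (Finset.mem_univ v)⟩

end Refinement

section LatticeRefinement

variable {n : ℕ} {T : SimplicialComplex ℝ (Fin n → ℝ)} {V : Type*} [Fintype V]
  {e : V ≃ T.vertices} {c : ℕ} {σ : Finset (Fin n → ℝ)}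

theorem isIntVector_realize (hT : T.vertices ⊆ latticePoints n) {m : V → ℝ}
    (hm : IsIntVector m) : IsIntVector (realize e m) := fun i => by
  rw [realize_apply, Finset.sum_apply]
  exact sum_mem fun v _ => mul_mem (hm v) (mem_latticePoints.1 (hT (e v).2) i)

variable [LinearOrder V] [NeZero c]

theorem isLatticeTriangulation_refinedComplex {P : Set (Fin n → ℝ)}
    (hT : IsLatticeTriangulation T P) :
    IsLatticeTriangulation (refinedComplex e c) ((c : ℝ) • P) where
  finite := finite_faces_refinedComplex
  vertices_subset := by
    rintro p ⟨x, -, hx⟩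
    obtain ⟨m, hm, rfl⟩ : p ∈ realize e '' cellVertices x := hx ▸ Finset.mem_singleton_self p
    exact mem_latticePoints.2 (isIntVector_realize hT.vertices_subset hm.2)
  space_eq := by rw [space_refinedComplex, hT.space_eq]

theorem simplices_refinedComplex :
    simplices (refinedComplex e c) = (fun x => realize e '' cell x) '' dilatedComplex e c := by
  ext C
  constructor
  · rintro ⟨t, ⟨x, hx, ht⟩, rfl⟩
    exact ⟨x, hx, (convexHull_eq_image_cell ht).symm⟩
  · rintro ⟨x, hx, rfl⟩
    obtain ⟨t, ht_mem, ht⟩ := exists_mem_faces_refinedComplex hx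
    exact ⟨t, ht_mem, convexHull_eq_image_cell ht⟩

theorem simplices_refinedComplex_subset (hσ : σ ∈ T.faces) :
    {C | C ∈ simplices (refinedComplex e c) ∧
      C ⊆ (c : ℝ) • convexHull ℝ (σ : Set (Fin n → ℝ))} =
      (fun x => realize e '' cell x) '' dilatedFace e c σ := by
  rw [simplices_refinedComplex]
  ext C
  constructor
  · rintro ⟨⟨x, hx, rfl⟩, hsub⟩
    exact ⟨x, mem_dilatedFace_of_realize_mem hσ hx
      (hsub (Set.mem_image_of_mem _ (mem_cell_self x))), rfl⟩
  · rintro ⟨x, hx, rfl⟩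
    refine ⟨⟨x, mem_dilatedComplex.2 ⟨σ, hσ, hx⟩, rfl⟩, ?_⟩
    rw [← image_realize_dilatedFace (e := e) hσ]
    exact Set.image_mono (cell_subset_dilatedFace hx)

end LatticeRefinement

section Extension

variable {ι V : Type*} [Fintype ι] [Fintype V] {a : ι → V}

theorem sum_extend_zero {M : Type*} [AddCommMonoid M] (ha : Function.Injective a) (ξ : ι → ℝ)
    {F : V → ℝ → M} (hF : ∀ v, F v 0 = 0) :
    ∑ v, F v (Function.extend a ξ 0 v) = ∑ i, F (a i) (ξ i) :=
  (Fintype.sum_of_injective a ha _ _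
    (fun v hv => by rw [Function.extend_apply' _ _ _ hv, Pi.zero_apply, hF])
    fun i => by rw [ha.extend_apply]).symm

theorem upperSum_extend_zero [PartialOrder ι] [PartialOrder V] (ha : Function.Injective a)
    (ha_mono : Monotone a) (ξ : ι → ℝ) (U : UpperSet V) :
    upperSum (Function.extend a ξ 0) U =
      upperSum ξ ⟨a ⁻¹' U, U.upper.preimage ha_mono⟩ := by
  classical
  simp only [upperSum_apply, Finset.sum_filter]
  exact sum_extend_zero ha ξ (F := fun v t => if v ∈ U then t else 0) fun v => ite_self 0

variable {E : Type*} [AddCommGroup E] [Module ℝ E] {T : SimplicialComplex ℝ E}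
  {e : V ≃ T.vertices} {c : ℕ} {σ : Finset E}

theorem realize_extend_zero (ha : Function.Injective a) (ξ : ι → ℝ) :
    realize e (Function.extend a ξ 0) = ∑ i, ξ i • (e (a i) : E) := by
  rw [realize_apply]
  exact sum_extend_zero ha ξ (F := fun v t => t • (e v : E)) fun v => zero_smul ℝ _

theorem dilatedFace_eq_image_extend_zero (ha : Function.Injective a)
    (hσ : (σ : Set E) = Set.range fun i => (e (a i) : E)) :
    dilatedFace e c σ =
      (fun ξ => (Function.extend a ξ 0 : V → ℝ)) '' {ξ : ι → ℝ | 0 ≤ ξ ∧ ∑ i, ξ i = c} := by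
  have hmem : ∀ v, (e v : E) ∈ σ ↔ ∃ i, a i = v := fun v => by
    simp [← Finset.mem_coe, hσ, Subtype.val_inj]
  have hsum : ∀ ξ : ι → ℝ, ∑ v, Function.extend a ξ 0 v = ∑ i, ξ i := fun ξ =>
    sum_extend_zero ha ξ (F := fun _ t => t) fun _ => rfl
  ext x
  constructor
  · rintro ⟨hx, hx_sum, hxσ⟩
    have hext : Function.extend a (x ∘ a) 0 = x := by
      ext v
      by_cases hv : ∃ i, a i = v
      · obtain ⟨i, rfl⟩ := hv
        exact ha.extend_apply _ _ _
      · rw [Function.extend_apply' _ _ _ hv, hxσ v (mt (hmem v).1 hv), Pi.zero_apply]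
    exact ⟨x ∘ a, ⟨fun i => hx (a i), by rw [← hsum, hext, hx_sum]⟩, hext⟩
  · rintro ⟨ξ, ⟨hξ, hξ_sum⟩, rfl⟩
    refine ⟨fun v => ?_, (hsum ξ).trans hξ_sum, fun v hv => ?_⟩
    · by_cases hv : ∃ i, a i = v
      · obtain ⟨i, rfl⟩ := hv
        exact (hξ i).trans_eq (ha.extend_apply _ _ _).symm
      · exact (Function.extend_apply' _ _ _ hv).ge
    · exact Function.extend_apply' _ _ _ (mt (hmem v).2 hv)

end Extension

section TypeA

variable {d : ℕ}

/-- The linear map taking the unit vectors to the vertices of the simplex of type `A`. -/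
noncomputable def typeAMap (d : ℕ) : (Fin (d + 1) → ℝ) →ₗ[ℝ] Fin (d + 1) → ℝ :=
  Fintype.linearCombination ℝ (typeAVertex d)

theorem typeAMap_eq_sum (ξ : Fin (d + 1) → ℝ) :
    typeAMap d ξ = ∑ i, ξ i • typeAVertex d i :=
  Fintype.linearCombination_apply ..

theorem typeAMap_apply (ξ : Fin (d + 1) → ℝ) (k : Fin (d + 1)) :
    typeAMap d ξ k = upperSum ξ (UpperSet.Ici k) := by
  classical
  simp [typeAMap_eq_sum, upperSum_apply, typeAVertex, Finset.sum_apply, Pi.single_apply,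
    Finset.sum_filter]

theorem typeAMap_injective : Function.Injective (typeAMap d) := fun ξ ζ h => by
  refine upperSum_injective (funext fun U => ?_)
  obtain rfl | ⟨k, rfl⟩ := eq_top_or_exists_eq_Ici U
  · rw [upperSum_top, upperSum_top]
  · rw [← typeAMap_apply, ← typeAMap_apply, h]

theorem smul_typeASimplex (c : ℕ) [NeZero c] :
    (c : ℝ) • typeASimplex d = typeAMap d '' {ξ | 0 ≤ ξ ∧ ∑ i, ξ i = c} := by
  have hc : (0 : ℝ) < c := Nat.cast_pos.2 (NeZero.pos c)
  have hrange : Set.range (typeAVertex d) =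
      typeAMap d '' Set.range fun i j : Fin (d + 1) => if i = j then (1 : ℝ) else 0 := by
    rw [← Set.range_comp]
    congr 1
    ext1 i
    simp [typeAMap_eq_sum, ite_smul]
  rw [typeASimplex, hrange, ← LinearMap.image_convexHull, convexHull_basis_eq_stdSimplex,
    ← image_smul_set]
  congr 1
  ext ξ
  rw [Set.mem_smul_set_iff_inv_smul_mem₀ hc.ne']
  simp only [stdSimplex, Set.mem_ofPred_eq, Pi.smul_apply, smul_eq_mul, ← Finset.mul_sum]
  rw [inv_mul_eq_one₀ hc.ne', eq_comm (a := (c : ℝ))]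
  simp [hc, Pi.le_def]

theorem exists_upperSum_eq_typeAMap_add (c : ℕ) (U : UpperSet (Fin (d + 1))) :
    ∃ (k : Fin (d + 1)) (r : ℤ), ∀ ξ : Fin (d + 1) → ℝ, ∑ i, ξ i = c →
      upperSum ξ U = typeAMap d ξ k + r := by
  obtain rfl | ⟨k, rfl⟩ := eq_top_or_exists_eq_Ici U
  · refine ⟨0, -c, fun ξ hξ => ?_⟩
    have hbot : UpperSet.Ici (0 : Fin (d + 1)) = ⊥ := UpperSet.Ici_bot
    simp [typeAMap_apply, hbot, upperSum_bot, hξ, upperSum_top]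
  · exact ⟨k, 0, fun ξ _ => by simp [typeAMap_apply]⟩

theorem mem_cell_iff_typeAMap {c : ℕ} {ξ ζ : Fin (d + 1) → ℝ} (hξ : ∑ i, ξ i = c)
    (hζ : ∑ i, ζ i = c) :
    ξ ∈ cell ζ ↔ ∀ i j, (⌊typeAMap d ζ i - typeAMap d ζ j⌋ : ℝ) ≤ typeAMap d ξ i - typeAMap d ξ j ∧
      typeAMap d ξ i - typeAMap d ξ j ≤ (⌈typeAMap d ζ i - typeAMap d ζ j⌉ : ℝ) := by
  constructor
  · intro h i j
    simp only [typeAMap_apply, ← upperDiff_apply]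
    exact ⟨floor_le_upperDiff_of_mem_cell h _ _, h _ _⟩
  · intro h U W
    obtain ⟨i, r, hU⟩ := exists_upperSum_eq_typeAMap_add c U
    obtain ⟨j, s, hW⟩ := exists_upperSum_eq_typeAMap_add c W
    have hdiff : ∀ χ : Fin (d + 1) → ℝ, ∑ i, χ i = c →
        upperDiff U W χ = typeAMap d χ i - typeAMap d χ j + (r - s : ℤ) := fun χ hχ => by
      rw [upperDiff_apply, hU χ hχ, hW χ hχ]
      push_cast
      ring
    rw [hdiff ξ hξ, hdiff ζ hζ, Int.ceil_add_intCast, Int.cast_add]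
    exact add_le_add_left (h i j).2 _

variable {V : Type*} [LinearOrder V] [Fintype V] {a : Fin (d + 1) → V}

theorem extend_zero_mem_cell_iff (ha : StrictMono a) {ξ ζ : Fin (d + 1) → ℝ} :
    Function.extend a ξ 0 ∈ cell (Function.extend a ζ 0) ↔ ξ ∈ cell ζ := by
  have hpre : ∀ U : UpperSet (Fin (d + 1)), ∃ W : UpperSet V, ∀ χ : Fin (d + 1) → ℝ,
      upperSum (Function.extend a χ 0) W = upperSum χ U := fun U => by
    obtain rfl | ⟨k, rfl⟩ := eq_top_or_exists_eq_Ici U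
    · exact ⟨⊤, fun χ => by rw [upperSum_top, upperSum_top]⟩
    · refine ⟨UpperSet.Ici (a k), fun χ => ?_⟩
      rw [upperSum_extend_zero ha.injective ha.monotone]
      exact congrArg (upperSum χ) (UpperSet.ext (Set.ext fun i => ha.le_iff_le))
  constructor
  · intro h U W
    obtain ⟨U', hU⟩ := hpre U
    obtain ⟨W', hW⟩ := hpre W
    simpa only [upperDiff_apply, hU, hW] using h U' W'
  · intro h U W
    simp only [upperDiff_apply, upperSum_extend_zero ha.injective ha.monotone]
    exact h _ _

variable {n : ℕ} {T : SimplicialComplex ℝ (Fin n → ℝ)} {e : V ≃ T.vertices} {c : ℕ} [NeZero c]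
  {σ : Finset (Fin n → ℝ)}

theorem setOf_typeA_slice_eq_image_cell (ha : StrictMono a)
    (hσ : (σ : Set (Fin n → ℝ)) = Set.range fun i => (e (a i) : Fin n → ℝ))
    {ζ : Fin (d + 1) → ℝ} (hζ : 0 ≤ ζ) (hζ_sum : ∑ i, ζ i = c) :
    {p | ∃ ξ : Fin (d + 1) → ℝ, ∑ i, ξ i • typeAVertex d i ∈
      {z | z ∈ (c : ℝ) • typeASimplex d ∧ ∀ i j : Fin (d + 1),
        (⌊typeAMap d ζ i - typeAMap d ζ j⌋ : ℝ) ≤ z i - z j ∧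
        z i - z j ≤ (⌈typeAMap d ζ i - typeAMap d ζ j⌉ : ℝ)} ∧
      ∑ i, ξ i • (e (a i) : Fin n → ℝ) = p} =
    realize e '' cell (Function.extend a ζ 0) := by
  have hface := dilatedFace_eq_image_extend_zero (c := c) ha.injective hσ
  ext p
  simp only [← typeAMap_eq_sum, smul_typeASimplex, Set.mem_ofPred_eq,
    typeAMap_injective.mem_set_image, ← realize_extend_zero ha.injective]
  constructor
  · rintro ⟨ξ, ⟨⟨-, hξ_sum⟩, h⟩, rfl⟩
    exact ⟨_, (extend_zero_mem_cell_iff ha).2 ((mem_cell_iff_typeAMap hξ_sum hζ_sum).2 h), rfl⟩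
  · rintro ⟨y, hy, rfl⟩
    have hζσ : Function.extend a ζ 0 ∈ dilatedFace e c σ := hface ▸ ⟨ζ, ⟨hζ, hζ_sum⟩, rfl⟩
    obtain ⟨ξ, hξ, rfl⟩ := hface ▸ cell_subset_dilatedFace hζσ hy
    exact ⟨ξ, ⟨hξ, (mem_cell_iff_typeAMap hξ.2 hζ_sum).1 ((extend_zero_mem_cell_iff ha).1 hy)⟩, rfl⟩

theorem canonicalTriangulation_eq_image_cell (ha : StrictMono a)
    (hσ : (σ : Set (Fin n → ℝ)) = Set.range fun i => (e (a i) : Fin n → ℝ)) :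
    canonicalTriangulation c (fun i => (e (a i) : Fin n → ℝ)) =
      (fun x => realize e '' cell x) '' dilatedFace e c σ := by
  rw [dilatedFace_eq_image_extend_zero ha.injective hσ]
  ext C
  constructor
  · rintro ⟨_, ⟨y, hy, rfl⟩, rfl⟩
    rw [smul_typeASimplex] at hy
    obtain ⟨ζ, hζ, rfl⟩ := hy
    exact ⟨_, ⟨ζ, hζ, rfl⟩, (setOf_typeA_slice_eq_image_cell ha hσ hζ.1 hζ.2).symm⟩
  · rintro ⟨_, ⟨ζ, hζ, rfl⟩, rfl⟩
    refine ⟨_, ⟨typeAMap d ζ, ?_, rfl⟩, (setOf_typeA_slice_eq_image_cell ha hσ hζ.1 hζ.2).symm⟩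
    rw [smul_typeASimplex]
    exact Set.mem_image_of_mem _ hζ

end TypeA

section Flag

variable {n : ℕ} {T : SimplicialComplex ℝ (Fin n → ℝ)}

open Classical in
theorem isFlag_iff : IsFlag T ↔ ∀ N : Finset (Fin n → ℝ), N.Nonempty →
    (∀ p ∈ N, ∀ q ∈ N, {p, q} ∈ T.faces) → N ∈ T.faces := by
  constructor
  · intro hT N
    induction N using Finset.strongInduction with
    | H N ih =>
      intro hne hpair
      by_contra hN
      have hsub : (N : Set (Fin n → ℝ)) ⊆ T.vertices := fun p hp => by
        simpa only [Finset.pair_eq_singleton, SimplicialComplex.mem_vertices] using hpair p hp p hp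
      have hcard := hT N hne hsub hN fun M hM hMne =>
        ih M hM hMne fun p hp q hq => hpair p (hM.1 hp) q (hM.1 hq)
      obtain ⟨p, q, -, rfl⟩ := Finset.card_eq_two.1 hcard
      exact hN (hpair p (by simp) q (by simp))
  · intro h N hne hsub hN hmin
    by_contra hcard
    refine hN (h N hne fun p hp q hq => ?_)
    by_cases hpq : p = q
    · simpa only [hpq, Finset.pair_eq_singleton, SimplicialComplex.mem_vertices] using hsub hq
    · refine hmin _ (Finset.ssubset_iff_subset_ne.2 ⟨?_, ?_⟩) (Finset.insert_nonempty _ _)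
      · exact Finset.insert_subset hp (Finset.singleton_subset_iff.2 hq)
      · rintro rfl
        exact hcard (Finset.card_pair hpq)

variable {V : Type*} [Fintype V] {e : V ≃ T.vertices} {c : ℕ} [NeZero c]

theorem IsFlag.exists_dilatedFace_of_pairwise (hT : IsFlag T) {S : Set (V → ℝ)}
    (hne : S.Nonempty)
    (hpair : ∀ x ∈ S, ∀ y ∈ S, ∃ σ ∈ T.faces, x ∈ dilatedFace e c σ ∧ y ∈ dilatedFace e c σ) :
    ∃ σ ∈ T.faces, S ⊆ dilatedFace e c σ := by
  classical
  let support : Finset (Fin n → ℝ) :=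
    ({v | ∃ x ∈ S, x v ≠ 0} : Finset V).image fun v => (e v : Fin n → ℝ)
  have hmem : ∀ v, (e v : Fin n → ℝ) ∈ support ↔ ∃ x ∈ S, x v ≠ 0 := fun v => by
    simp [support, Subtype.val_inj]
  have hsupport_ne : support.Nonempty := by
    obtain ⟨x, hx⟩ := hne
    obtain ⟨σ, -, hxσ, -⟩ := hpair x hx x hx
    obtain ⟨v, -, hv⟩ := Finset.exists_ne_zero_of_sum_ne_zero
      (hxσ.2.1.trans_ne (NeZero.ne (c : ℝ)))
    exact ⟨e v, (hmem v).2 ⟨x, hx, hv⟩⟩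
  refine ⟨support, isFlag_iff.1 hT _ hsupport_ne fun p hp q hq => ?_, fun x hx => ?_⟩
  · obtain ⟨v, -, rfl⟩ := Finset.mem_image.1 hp
    obtain ⟨w, -, rfl⟩ := Finset.mem_image.1 hq
    obtain ⟨x, hx, hxv⟩ := (hmem v).1 hp
    obtain ⟨y, hy, hyw⟩ := (hmem w).1 hq
    obtain ⟨σ, hσ, hxσ, hyσ⟩ := hpair x hx y hy
    refine T.down_closed hσ (Finset.insert_subset ?_ (Finset.singleton_subset_iff.2 ?_))
      (Finset.insert_nonempty _ _)
    · exact by_contra fun h => hxv (hxσ.2.2 v h)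
    · exact by_contra fun h => hyw (hyσ.2.2 w h)
  · obtain ⟨σ, -, hxσ, -⟩ := hpair x hx x hx
    exact ⟨hxσ.1, hxσ.2.1, fun v hv => by_contra fun h => hv ((hmem v).2 ⟨x, hx, h⟩)⟩

variable [LinearOrder V]

theorem mem_cellVertices_of_realize_mem {x m : V → ℝ} (hx : x ∈ dilatedComplex e c)
    (hm : m ∈ dilatedComplex e c) (h : realize e m ∈ realize e '' cellVertices x) :
    m ∈ cellVertices x := by
  obtain ⟨m', hm', hmm'⟩ := h
  rwa [← injOn_realize_dilatedComplex (cell_subset_dilatedComplex hx hm'.1) hm hmm']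

theorem isFlag_refinedComplex (hT : IsFlag T) : IsFlag (refinedComplex e c) := by
  classical
  refine isFlag_iff.2 fun N hne hpair => ?_
  have hlift : ∀ p ∈ N, ∃ m ∈ dilatedComplex e c, realize e m = p := fun p hp => by
    obtain ⟨x, hx, hpx⟩ := hpair p hp p hp
    obtain ⟨m, hm, hmp⟩ : p ∈ realize e '' cellVertices x :=
      hpx ▸ Finset.mem_insert_self p {p}
    exact ⟨m, cell_subset_dilatedComplex hx hm.1, hmp⟩
  choose! lift hlift_mem hlift_eq using hlift
  have hcell : ∀ p ∈ N, ∀ q ∈ N, ∃ x ∈ dilatedComplex e c,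
      lift p ∈ cellVertices x ∧ lift q ∈ cellVertices x := fun p hp q hq => by
    obtain ⟨x, hx, hpq⟩ := hpair p hp q hq
    have hmem : ∀ r ∈ N, r ∈ ({p, q} : Finset (Fin n → ℝ)) → lift r ∈ cellVertices x :=
      fun r hr hrpq => mem_cellVertices_of_realize_mem hx (hlift_mem r hr)
        (by rw [hlift_eq r hr, ← hpq]; exact hrpq)
    exact ⟨x, hx, hmem p hp (by simp), hmem q hq (by simp)⟩
  obtain ⟨σ, hσ, hNσ⟩ := hT.exists_dilatedFace_of_pairwise (e := e) (c := c)
    (S := lift '' N) (hne.to_set.image lift) <| by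
      rintro _ ⟨p, hp, rfl⟩ _ ⟨q, hq, rfl⟩
      obtain ⟨x, hx, hpx, hqx⟩ := hcell p hp q hq
      obtain ⟨σ, hσ, hxσ⟩ := mem_dilatedComplex.1 hx
      exact ⟨σ, hσ, cell_subset_dilatedFace hxσ hpx.1, cell_subset_dilatedFace hxσ hqx.1⟩
  rw [← Finset.coe_image] at hNσ
  refine IsCompatibleFamily.mem_faces_refinedComplex ⟨?_, ?_⟩ (hne.image lift) hσ hNσ ?_
  · simp only [Finset.coe_image, Set.forall_mem_image]
    intro p hp
    obtain ⟨x, -, hpx, -⟩ := hcell p hp p hp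
    exact hpx.2
  · simp only [Finset.coe_image, Set.forall_mem_image]
    intro p hp q hq
    obtain ⟨x, -, hpx, hqx⟩ := hcell p hp q hq
    exact (isCompatibleFamily_cellVertices x).compatible _ hpx _ hqx
  · rw [Finset.coe_image, Set.image_image, Set.image_congr hlift_eq, Set.image_id']

end Flag

section Unimodular

variable {ι : Type*} {n d : ℕ} {σ : Finset (Fin n → ℝ)} {μ : (Fin n → ℝ) → ℝ}

theorem isIntVector_sum_smul {s : Finset ι} {v : ι → Fin n → ℝ} {w : ι → ℝ}
    (hv : ∀ i ∈ s, IsIntVector (v i)) (hw : ∀ i ∈ s, w i ∈ intReals) :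
    IsIntVector (∑ i ∈ s, w i • v i) := fun j => by
  rw [Finset.sum_apply]
  exact sum_mem fun i hi => mul_mem (hw i hi) (hv i hi j)

theorem weights_mem_intReals_of_standardSimplex {s : Finset ι} {b : ι → Fin d → ℝ} {w : ι → ℝ}
    (hb : ∀ i ∈ s, b i ∈ insert 0 (Set.range fun j : Fin d => (Pi.single j 1 : Fin d → ℝ)))
    (hb_inj : Set.InjOn b s) (hw : ∑ i ∈ s, w i = 1) (hint : IsIntVector (∑ i ∈ s, w i • b i)) :
    ∀ i ∈ s, w i ∈ intReals := by
  classical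
  -- The barycentric coordinate of a vertex is an affine function with integer coefficients.
  have hdual : ∀ i ∈ s, ∃ g : (Fin d → ℝ) →ₗ[ℝ] ℝ, ∃ k ∈ intReals,
      (∀ x, IsIntVector x → g x ∈ intReals) ∧ ∀ i' ∈ s, g (b i') + k = if i' = i then 1 else 0 := by
    intro i hi
    obtain hzero | ⟨j, hj⟩ := hb i hi
    · refine ⟨-∑ j, LinearMap.proj j, 1, one_mem _, fun x hx => ?_, fun i' hi' => ?_⟩
      · simpa using sum_mem fun j _ => hx j
      · rw [← hb_inj.eq_iff hi' hi, hzero]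
        obtain hzero' | ⟨j, hj⟩ := hb i' hi'
        · simp [hzero']
        · simp [← hj]
    · refine ⟨LinearMap.proj j, 0, zero_mem _, fun x hx => hx j, fun i' hi' => ?_⟩
      rw [← hb_inj.eq_iff hi' hi, ← hj]
      obtain hzero' | ⟨j', hj'⟩ := hb i' hi'
      · simp [hzero', eq_comm (a := (0 : Fin d → ℝ))]
      · have hjj' : (Pi.single j' 1 : Fin d → ℝ) = Pi.single j 1 ↔ j = j' :=
          ⟨fun h => by simpa [Pi.single_apply, eq_comm] using congrFun h j', fun h => by rw [h]⟩
        simp [← hj', Pi.single_apply, hjj']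
  intro i hi
  obtain ⟨g, k, hk, hg, hgi⟩ := hdual i hi
  have heq : w i = g (∑ i' ∈ s, w i' • b i') + k := by
    have hk_sum : k = ∑ i' ∈ s, w i' * k := by rw [← Finset.sum_mul, hw, one_mul]
    rw [map_sum, hk_sum, ← Finset.sum_add_distrib]
    simp only [map_smul, smul_eq_mul, ← mul_add]
    rw [Finset.sum_congr rfl fun i' hi' => by rw [hgi i' hi']]
    simp [hi]
  exact heq ▸ add_mem (hg _ hint) hk

theorem IsUnimodularSimplex.weights_mem_intReals_of_sum_eq_one
    (hσ : AffineIndependent ℝ ((↑) : σ → Fin n → ℝ))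
    (h : IsUnimodularSimplex (convexHull ℝ (σ : Set (Fin n → ℝ)))) (hμ : ∑ p ∈ σ, μ p = 1)
    (hint : IsIntVector (∑ p ∈ σ, μ p • p)) : ∀ p ∈ σ, μ p ∈ intReals := by
  obtain ⟨d, f, hf, hlattice, himage⟩ := h
  rw [standardSimplex, AffineMap.image_convexHull] at himage
  have hvertex : ∀ p ∈ σ, ∃ b ∈ _, f b = p := fun p hp => coe_subset_of_convexHull_eq hσ himage hp
  choose! b hb hfb using hvertex
  have hspan : ∑ p ∈ σ, μ p • p ∈ affineSpan ℝ (convexHull ℝ (σ : Set (Fin n → ℝ))) := by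
    have hmem := affineCombination_mem_affineSpan_image (p := id) hμ fun p hp hpσ => absurd hp hpσ
    rwa [Finset.affineCombination_eq_linear_combination _ _ _ hμ, Set.image_id,
      ← affineSpan_convexHull] at hmem
  obtain ⟨q, hq, hfq⟩ : ∑ p ∈ σ, μ p • p ∈ f '' latticePoints d :=
    hlattice ▸ ⟨mem_latticePoints.2 hint, hspan⟩
  have hq_eq : q = ∑ p ∈ σ, μ p • b p := hf <| by
    have hmap := Finset.map_affineCombination σ b μ hμ f
    rw [Finset.affineCombination_eq_linear_combination _ _ _ hμ,
      Finset.affineCombination_eq_linear_combination _ _ _ hμ] at hmap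
    rw [hfq, hmap]
    exact Finset.sum_congr rfl fun p hp => by rw [Function.comp_apply, hfb p hp]
  exact weights_mem_intReals_of_standardSimplex hb
    (fun p hp p' hp' hpp' => by rw [← hfb p hp, ← hfb p' hp', hpp']) hμ
    (hq_eq ▸ mem_latticePoints.1 hq)

theorem IsUnimodularSimplex.weights_mem_intReals (hσ : AffineIndependent ℝ ((↑) : σ → Fin n → ℝ))
    (h : IsUnimodularSimplex (convexHull ℝ (σ : Set (Fin n → ℝ))))
    (hσ_int : ∀ p ∈ σ, IsIntVector p) (hμ : ∑ p ∈ σ, μ p ∈ intReals)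
    (hint : IsIntVector (∑ p ∈ σ, μ p • p)) : ∀ p ∈ σ, μ p ∈ intReals := by
  classical
  intro p hp
  set k := ∑ p ∈ σ, μ p - 1
  have hk : k ∈ intReals := sub_mem hμ (one_mem _)
  let ν : (Fin n → ℝ) → ℝ := μ - Pi.single p k
  have hν : ∑ q ∈ σ, ν q = 1 := by simp [ν, Finset.sum_sub_distrib, hp, k]
  have hν_sum : ∑ q ∈ σ, ν q • q = ∑ q ∈ σ, μ q • q - k • p := by
    simp [ν, sub_smul, Finset.sum_sub_distrib, Pi.single_apply, ite_smul, hp]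
  have hνp := h.weights_mem_intReals_of_sum_eq_one (μ := ν) hσ hν
    (hν_sum ▸ fun i => sub_mem (hint i) (mul_mem hk (hσ_int p hp i))) p hp
  simpa [ν] using add_mem hνp hk

end Unimodular

section SimplexMap

variable {n d : ℕ} {v : Fin (d + 1) → Fin n → ℝ}

/-- The barycentric coordinates of a point of `ℝᵈ` with respect to `0, e₁, …, e_d`. -/
def standardWeights (q : Fin d → ℝ) : Fin (d + 1) → ℝ := Fin.cons (1 - ∑ i, q i) q

theorem sum_standardWeights (q : Fin d → ℝ) : ∑ i, standardWeights q i = 1 := by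
  simp [standardWeights, Fin.sum_univ_succ]

theorem standardWeights_tail {w : Fin (d + 1) → ℝ} (hw : ∑ i, w i = 1) :
    standardWeights (Fin.tail w) = w := by
  rw [Fin.sum_univ_succ, ← eq_sub_iff_add_eq] at hw
  rw [standardWeights, Fin.tail_def, ← hw]
  exact Fin.cons_self_tail w

theorem isIntVector_standardWeights {q : Fin d → ℝ} (hq : IsIntVector q) :
    IsIntVector (standardWeights q) :=
  Fin.cases (sub_mem (one_mem _) (sum_mem fun i _ => hq i)) hq

/-- The affine map with `0 ↦ v 0` and `eᵢ ↦ v i` for `1 ≤ i ≤ d`. -/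
noncomputable def simplexMap (v : Fin (d + 1) → Fin n → ℝ) : (Fin d → ℝ) →ᵃ[ℝ] (Fin n → ℝ) :=
  (Fintype.linearCombination ℝ fun i : Fin d => v i.succ - v 0).toAffineMap +
    AffineMap.const ℝ _ (v 0)

theorem simplexMap_apply (q : Fin d → ℝ) :
    simplexMap v q = ∑ i, standardWeights q i • v i := by
  simp only [simplexMap, AffineMap.coe_add, Pi.add_apply, LinearMap.coe_toAffineMap,
    Fintype.linearCombination_apply, AffineMap.const_apply, standardWeights, Fin.sum_univ_succ,
    Fin.cons_zero, Fin.cons_succ, smul_sub, Finset.sum_sub_distrib, sub_smul, one_smul,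
    Finset.sum_smul]
  abel

theorem simplexMap_injective (hv : AffineIndependent ℝ v) : Function.Injective (simplexMap v) := by
  intro q q' h
  rw [simplexMap_apply, simplexMap_apply] at h
  have hweights := affineIndependent_iff.1 hv Finset.univ
    (fun i => standardWeights q i - standardWeights q' i)
    (by rw [Finset.sum_sub_distrib, sum_standardWeights, sum_standardWeights, sub_self])
    (by simp only [sub_smul, Finset.sum_sub_distrib, h, sub_self])
  ext i
  exact sub_eq_zero.1 (hweights i.succ (Finset.mem_univ _))

theorem image_simplexMap_standardSimplex :
    simplexMap v '' standardSimplex d = convexHull ℝ (Set.range v) := by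
  rw [standardSimplex, AffineMap.image_convexHull]
  congr 1
  have hzero : simplexMap v 0 = v 0 := by simp [simplexMap]
  have hsingle : ∀ i, simplexMap v (Pi.single i 1) = v i.succ := fun i => by
    simp [simplexMap, Fintype.linearCombination_apply, Pi.single_apply, ite_smul]
  rw [Set.image_insert_eq, hzero, ← Set.range_comp]
  ext p
  simp only [Set.mem_insert_iff, Set.mem_range, Function.comp_apply, hsingle, Fin.exists_fin_succ]
  rw [eq_comm]

theorem image_simplexMap_latticePoints (hv : ∀ i, IsIntVector (v i))
    (hweights : ∀ w : Fin (d + 1) → ℝ, ∑ i, w i = 1 → IsIntVector (∑ i, w i • v i) →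
      IsIntVector w) :
    simplexMap v '' latticePoints d =
      latticePoints n ∩ (affineSpan ℝ (convexHull ℝ (Set.range v)) : Set (Fin n → ℝ)) := by
  rw [affineSpan_convexHull]
  ext p
  constructor
  · rintro ⟨q, hq, rfl⟩
    rw [simplexMap_apply]
    refine ⟨mem_latticePoints.2 (isIntVector_sum_smul (fun i _ => hv i) fun i _ =>
      isIntVector_standardWeights (mem_latticePoints.1 hq) i), ?_⟩
    rw [← Finset.affineCombination_eq_linear_combination _ _ _ (sum_standardWeights q)]
    exact affineCombination_mem_affineSpan (sum_standardWeights q) v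
  · rintro ⟨hp, hspan⟩
    obtain ⟨w, hw, rfl⟩ := eq_affineCombination_of_mem_affineSpan_of_fintype hspan
    rw [Finset.affineCombination_eq_linear_combination _ _ _ hw] at hp ⊢
    refine ⟨Fin.tail w, mem_latticePoints.2 fun i => hweights w hw (mem_latticePoints.1 hp) i.succ,
      ?_⟩
    rw [simplexMap_apply, standardWeights_tail hw]

theorem isUnimodularSimplex_of_weights_mem_intReals {σ : Finset (Fin n → ℝ)} (hne : σ.Nonempty)
    (hσ : AffineIndependent ℝ ((↑) : σ → Fin n → ℝ)) (hσ_int : ∀ p ∈ σ, IsIntVector p)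
    (hweights : ∀ μ : (Fin n → ℝ) → ℝ, ∑ p ∈ σ, μ p = 1 → IsIntVector (∑ p ∈ σ, μ p • p) →
      ∀ p ∈ σ, μ p ∈ intReals) :
    IsUnimodularSimplex (convexHull ℝ (σ : Set (Fin n → ℝ))) := by
  obtain ⟨d, hd⟩ := Nat.exists_eq_add_one_of_ne_zero hne.card_pos.ne'
  let vertex : Fin (d + 1) ≃ σ := (σ.equivFinOfCardEq hd).symm
  let v : Fin (d + 1) → Fin n → ℝ := fun i => vertex i
  have hv_inj : Function.Injective v := Subtype.val_injective.comp vertex.injective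
  have hv_range : (σ : Set (Fin n → ℝ)) = Set.range v := by
    rw [show v = (↑) ∘ vertex from rfl, vertex.surjective.range_comp, Subtype.range_coe]
  have hv_sum : ∀ {M : Type} [AddCommMonoid M] (F : (Fin n → ℝ) → M),
      ∑ p ∈ σ, F p = ∑ i, F (v i) := fun F => by
    rw [← Finset.sum_coe_sort, ← Equiv.sum_comp vertex]
  rw [hv_range]
  refine ⟨d, simplexMap v, simplexMap_injective (hσ.comp_embedding vertex.toEmbedding),
    image_simplexMap_latticePoints (fun i => hσ_int _ (vertex i).2) fun w hw hint i => ?_,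
    image_simplexMap_standardSimplex⟩
  have hext := hv_inj.extend_apply w 0
  rw [← hext i]
  exact hweights (Function.extend v w 0) (by simp only [hv_sum, hext, hw])
    (by simpa only [hv_sum, hext] using hint) (v i) (vertex i).2

end SimplexMap

section UnimodularRefinement

theorem IsCompatibleFamily.coefficient_mem_intReals {V : Type*} [PartialOrder V] [Fintype V]
    {S : Finset (V → ℝ)} {μ : (V → ℝ) → ℝ} (hS : IsCompatibleFamily (S : Set (V → ℝ)))
    (hμ : ∑ m ∈ S, μ m ∈ intReals) (hint : IsIntVector (∑ m ∈ S, μ m • m)) :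
    ∀ m ∈ S, μ m ∈ intReals := by
  intro m hm
  obtain ⟨U, W, hcoeff⟩ := hS.exists_coefficient_eq hm
  rw [hcoeff μ]
  exact sub_mem (hint.upperDiff U W)
    (mul_mem (sub_mem ((hS.isIntVector m hm).upperDiff U W) (one_mem _)) hμ)

theorem exists_facet_superset {E : Type*} [AddCommGroup E] [Module ℝ E]
    {T : SimplicialComplex ℝ E} (hT : T.faces.Finite) {σ : Finset E} (hσ : σ ∈ T.faces) :
    ∃ τ ∈ T.facets, σ ⊆ τ := by
  obtain ⟨τ, hστ, hτ⟩ := hT.exists_le_maximal hσ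
  exact ⟨τ, ⟨hτ.prop, fun t ht hsub => le_antisymm hsub (hτ.le_of_ge ht hsub)⟩, hστ⟩

variable {n : ℕ} {T : SimplicialComplex ℝ (Fin n → ℝ)} {V : Type*} [Fintype V]
  {e : V ≃ T.vertices} {c : ℕ} {P : Set (Fin n → ℝ)}

theorem isIntVector_of_isIntVector_realize (hT : T.vertices ⊆ latticePoints n)
    {τ : Finset (Fin n → ℝ)} (hτ : τ ∈ T.faces)
    (hτ_unimodular : IsUnimodularSimplex (convexHull ℝ (τ : Set (Fin n → ℝ)))) {x : V → ℝ}
    (hx_sum : ∑ v, x v ∈ intReals) (hx : ∀ v, (e v : Fin n → ℝ) ∉ τ → x v = 0)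
    (hint : IsIntVector (realize e x)) : IsIntVector x := by
  obtain ⟨w, hw, hw_sum, hw_realize⟩ := exists_weights hτ hx
  have hτ_int : ∀ p ∈ τ, IsIntVector p := fun p hp => by
    obtain ⟨v, rfl⟩ := exists_label e hτ hp
    exact mem_latticePoints.1 (hT (e v).2)
  have hw_int := hτ_unimodular.weights_mem_intReals (T.indep hτ) hτ_int (hw_sum ▸ hx_sum)
    (hw_realize ▸ hint)
  intro v
  by_cases hv : (e v : Fin n → ℝ) ∈ τ
  · exact hw v ▸ hw_int _ hv
  · exact hx v hv ▸ zero_mem _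

variable [LinearOrder V] [NeZero c]

theorem isUnimodular_refinedComplex (hT : IsLatticeTriangulation T P) (hT' : IsUnimodular T) :
    IsUnimodular (refinedComplex e c) := by
  rintro t ⟨ht, -⟩
  obtain ⟨x, hx, htx⟩ := id ht
  obtain ⟨σ, hσ, hxσ⟩ := mem_dilatedComplex.1 hx
  obtain ⟨τ, hτ, hστ⟩ := exists_facet_superset hT.finite hσ
  have hcompat := isCompatibleFamily_cellVertices x
  have hface : cellVertices x ⊆ dilatedFace e c τ := fun m hm =>
    dilatedFace_mono hστ (cell_subset_dilatedFace hxσ hm.1)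
  obtain ⟨S, hS⟩ := (finite_cellVertices x).exists_finset_coe
  rw [← hS] at htx hcompat hface
  refine isUnimodularSimplex_of_weights_mem_intReals
    ((refinedComplex e c).nonempty_of_mem_faces ht) ((refinedComplex e c).indep ht)
    (fun p hp => ?_) fun μ hμ hint p hp => ?_ <;>
    obtain ⟨m, hm, rfl⟩ : p ∈ realize e '' S := htx ▸ hp
  · exact isIntVector_realize hT.vertices_subset (hcompat.isIntVector m hm)
  · have hinj := (injOn_realize_dilatedFace hτ.1).mono hface
    rw [sum_eq_sum_of_coe_eq_image hinj htx] at hμ hint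
    refine hcompat.coefficient_mem_intReals (μ := fun m => μ (realize e m)) (hμ ▸ one_mem _) ?_ m hm
    refine isIntVector_of_isIntVector_realize hT.vertices_subset hτ.1 (hT' τ hτ) ?_
      (fun v hv => sum_smul_apply_eq_zero hface _ hv) ?_
    · rw [sum_sum_smul_apply hface, hμ, one_mul]
      exact intCast_mem_intReals c
    · simpa only [map_sum, map_smul] using hint

end UnimodularRefinement

section Supporting

variable {E : Type*} [AddCommGroup E] [Module ℝ E]

/-- The affine function `f` supports the weights `w` on `A`, that is, it does not exceed them, and
the points of `A` where both agree are those of `F`. -/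
structure CutsOut (f : E →ᵃ[ℝ] ℝ) (w : E → ℝ) (A F : Set E) : Prop where
  le : ∀ a ∈ A, f a ≤ w a
  eq_iff : ∀ a ∈ A, w a = f a ↔ a ∈ F

theorem CutsOut.mono {f : E →ᵃ[ℝ] ℝ} {w : E → ℝ} {A B F : Set E} (h : CutsOut f w A F)
    (hBA : B ⊆ A) : CutsOut f w B F :=
  ⟨fun a ha => h.le a (hBA ha), fun a ha => h.eq_iff a (hBA ha)⟩

theorem CutsOut.invFunOn {E' : Type*} [AddCommGroup E'] [Module ℝ E'] {φ : E' →ᵃ[ℝ] E}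
    {f : E →ᵃ[ℝ] ℝ} {w : E' → ℝ} {A F : Set E'} (h : CutsOut (f.comp φ) w A F)
    (hφ : Set.InjOn φ A) (hFA : F ⊆ A) :
    CutsOut f (w ∘ Function.invFunOn φ A) (φ '' A) (φ '' F) := by
  have hinv : ∀ x ∈ A, Function.invFunOn φ A (φ x) = x := fun x hx => hφ.leftInvOn_invFunOn hx
  refine ⟨?_, ?_⟩
  · rintro _ ⟨x, hx, rfl⟩
    simpa [hinv x hx] using h.le x hx
  · rintro _ ⟨x, hx, rfl⟩
    simpa [hinv x hx, hφ.mem_image_iff hFA hx] using h.eq_iff x hx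

theorem linear_sum_smul_add {ι : Type*} (f : E →ᵃ[ℝ] ℝ) (s : Finset ι) (w : ι → ℝ) (p : ι → E) :
    f.linear (∑ i ∈ s, w i • p i) + (∑ i ∈ s, w i) * f 0 = ∑ i ∈ s, w i * f (p i) := by
  have hf : ∀ q, f q = f.linear q + f 0 := fun q => congrFun f.decomp q
  rw [map_sum, Finset.sum_mul, ← Finset.sum_add_distrib]
  exact Finset.sum_congr rfl fun i _ => by rw [map_smul, smul_eq_mul, ← mul_add, ← hf]

theorem map_sum_smul_of_sum_eq_one (f : E →ᵃ[ℝ] ℝ) {s : Finset E} {w : E → ℝ}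
    (hw : ∑ p ∈ s, w p = 1) : f (∑ p ∈ s, w p • p) = ∑ p ∈ s, w p * f p := by
  rw [← linear_sum_smul_add f s w, hw, one_mul]
  exact congrFun f.decomp _

theorem map_sum_smul_le_of_le {f g : E →ᵃ[ℝ] ℝ} {s : Finset E} {w : E → ℝ}
    (hw : ∀ p ∈ s, 0 ≤ w p) (hw_sum : ∑ p ∈ s, w p = 1) (hle : ∀ p ∈ s, f p ≤ g p) :
    f (∑ p ∈ s, w p • p) ≤ g (∑ p ∈ s, w p • p) := by
  rw [map_sum_smul_of_sum_eq_one f hw_sum, map_sum_smul_of_sum_eq_one g hw_sum]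
  exact Finset.sum_le_sum fun p hp => mul_le_mul_of_nonneg_left (hle p hp) (hw p hp)

theorem eqOn_of_le_of_map_sum_smul_le {f g : E →ᵃ[ℝ] ℝ} {s : Finset E} {w : E → ℝ}
    (hw : ∀ p ∈ s, 0 < w p) (hw_sum : ∑ p ∈ s, w p = 1) (hle : ∀ p ∈ s, f p ≤ g p)
    (h : g (∑ p ∈ s, w p • p) ≤ f (∑ p ∈ s, w p • p)) : Set.EqOn f g s := by
  have hle' : ∀ p ∈ s, w p * f p ≤ w p * g p := fun p hp =>
    mul_le_mul_of_nonneg_left (hle p hp) (hw p hp).le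
  rw [map_sum_smul_of_sum_eq_one f hw_sum, map_sum_smul_of_sum_eq_one g hw_sum] at h
  have heq := (Finset.sum_eq_sum_iff_of_le hle').1 ((Finset.sum_le_sum hle').antisymm h)
  exact fun p hp => mul_left_cancel₀ (hw p hp).ne' (heq p hp)

theorem exists_face_pos_weights {T : SimplicialComplex ℝ E} {p : E} (hp : p ∈ T.space) :
    ∃ s ∈ T.faces, ∃ w : E → ℝ, (∀ q ∈ s, 0 < w q) ∧ ∑ q ∈ s, w q = 1 ∧
      ∑ q ∈ s, w q • q = p := by
  classical
  obtain ⟨s, hs, hps⟩ := SimplicialComplex.mem_space_iff.1 hp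
  obtain ⟨w, hw, hw_sum, hwp⟩ := Finset.mem_convexHull'.1 hps
  have hsum : ∑ q ∈ s with w q ≠ 0, w q = 1 := by rw [Finset.sum_filter_ne_zero, hw_sum]
  have hsum_smul : ∑ q ∈ s with w q ≠ 0, w q • q = p := by
    rw [Finset.sum_filter_of_ne fun q _ => left_ne_zero_of_smul, hwp]
  have hne : (s.filter fun q => w q ≠ 0).Nonempty :=
    Finset.nonempty_of_sum_ne_zero (hsum.trans_ne one_ne_zero)
  refine ⟨_, T.down_closed hs (Finset.filter_subset _ _) hne, w, fun q hq => ?_, hsum, hsum_smul⟩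
  rw [Finset.mem_filter] at hq
  exact (hw q hq.1).lt_of_ne' hq.2

end Supporting

section RegularityCriterion

theorem map_eq_sum_single {ι : Type*} [Fintype ι] [DecidableEq ι] (L : (ι → ℝ) →ₗ[ℝ] ℝ)
    (x : ι → ℝ) : L x = ∑ i, x i * L (Pi.single i 1) := by
  conv_lhs => rw [← Finset.univ_sum_single x, map_sum]
  exact Finset.sum_congr rfl fun i _ => by
    rw [← smul_eq_mul, ← map_smul, ← Pi.single_smul', smul_eq_mul, mul_one]

variable {n : ℕ} {T : SimplicialComplex ℝ (Fin n → ℝ)} {P : Set (Fin n → ℝ)}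
  {w : (Fin n → ℝ) → ℝ}

theorem mem_regularSubdivision {F : Set (Fin n → ℝ)} :
    F ∈ regularSubdivision P w ↔ F.Nonempty ∧ ∃ f : (Fin n → ℝ) →ᵃ[ℝ] ℝ,
      (∀ a ∈ P ∩ latticePoints n, f a ≤ w a) ∧
      F = convexHull ℝ {a | a ∈ P ∩ latticePoints n ∧ w a = f a} := by
  refine and_congr_right fun _ => ⟨?_, ?_⟩
  · rintro ⟨η, ζ, h⟩
    exact ⟨(dotProductBilin ℝ ℝ η).toAffineMap + AffineMap.const ℝ _ ζ, h⟩
  · rintro ⟨f, h⟩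
    have hf : ∀ a, f a = (fun i => f.linear (Pi.single i 1)) ⬝ᵥ a + f 0 := fun a => by
      rw [dotProduct_comm, congrFun f.decomp a, Pi.add_apply, map_eq_sum_single, dotProduct]
    refine ⟨fun i => f.linear (Pi.single i 1), f 0, ?_⟩
    simp only [← hf]
    exact h

theorem IsLatticeTriangulation.vertices_subset_inter (hT : IsLatticeTriangulation T P) :
    T.vertices ⊆ P ∩ latticePoints n := fun _ hp =>
  ⟨hT.space_eq ▸ SimplicialComplex.vertices_subset_space hp, hT.vertices_subset hp⟩

theorem IsLatticeTriangulation.finite_inter (hT : IsLatticeTriangulation T P) :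
    (P ∩ latticePoints n).Finite := by
  have hbdd : Bornology.IsBounded P := by
    rw [← hT.space_eq, SimplicialComplex.space, Bornology.isBounded_biUnion hT.finite]
    exact fun s _ => isBounded_convexHull.2 s.finite_toSet.isBounded
  obtain ⟨R, hR⟩ := hbdd.exists_norm_le
  refine (finite_setOf_isIntVector_of_mem_Icc (fun _ => -R) fun _ => R).subset fun p hp => ?_
  have hpR : ∀ i, |p i| ≤ R := fun i => (norm_le_pi_norm p i).trans (hR p hp.1)
  exact ⟨mem_latticePoints.1 hp.2, fun i => (abs_le.1 (hpR i)).1, fun i => (abs_le.1 (hpR i)).2⟩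

theorem CutsOut.convexHull_eq {f : (Fin n → ℝ) →ᵃ[ℝ] ℝ} {s : Finset (Fin n → ℝ)}
    (hT : IsLatticeTriangulation T P) (hs : s ∈ T.faces)
    (h : CutsOut f w (P ∩ latticePoints n) (convexHull ℝ (s : Set (Fin n → ℝ)))) :
    convexHull ℝ (s : Set (Fin n → ℝ)) =
      convexHull ℝ {a | a ∈ P ∩ latticePoints n ∧ w a = f a} := by
  have hsP := (coe_subset_vertices hs).trans hT.vertices_subset_inter
  exact Set.Subset.antisymm
    (convexHull_mono fun a ha => ⟨hsP ha, (h.eq_iff a (hsP ha)).2 (subset_convexHull ℝ _ ha)⟩)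
    (convexHull_min (fun a ha => (h.eq_iff a ha.1).1 ha.2) (convex_convexHull ℝ _))

/- The two supporting functions agree at a point in the relative interiors of both contact sets,
hence on both of these sets. -/
theorem CutsOut.convexHull_eq_of_sum_smul_eq {f g : (Fin n → ℝ) →ᵃ[ℝ] ℝ}
    {s A : Finset (Fin n → ℝ)} {μ κ : (Fin n → ℝ) → ℝ} (hT : IsLatticeTriangulation T P)
    (hs : s ∈ T.faces)
    (hf : CutsOut f w (P ∩ latticePoints n) (convexHull ℝ (s : Set (Fin n → ℝ))))
    (hg : CutsOut g w (P ∩ latticePoints n) A) (hA : (A : Set (Fin n → ℝ)) ⊆ P ∩ latticePoints n)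
    (hμ : ∀ u ∈ s, 0 < μ u) (hμ_sum : ∑ u ∈ s, μ u = 1)
    (hκ : ∀ a ∈ A, 0 < κ a) (hκ_sum : ∑ a ∈ A, κ a = 1)
    (heq : ∑ u ∈ s, μ u • u = ∑ a ∈ A, κ a • a) :
    convexHull ℝ (s : Set (Fin n → ℝ)) = convexHull ℝ (A : Set (Fin n → ℝ)) := by
  have hsP := (coe_subset_vertices hs).trans hT.vertices_subset_inter
  have hws : ∀ u ∈ s, w u = f u := fun u hu =>
    (hf.eq_iff u (hsP hu)).2 (subset_convexHull ℝ _ hu)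
  have hwA : ∀ a ∈ A, w a = g a := fun a ha => (hg.eq_iff a (hA ha)).2 ha
  have hle_s : ∀ u ∈ s, g u ≤ f u := fun u hu => (hg.le u (hsP hu)).trans_eq (hws u hu)
  have hle_A : ∀ a ∈ A, f a ≤ g a := fun a ha => (hf.le a (hA ha)).trans_eq (hwA a ha)
  have hfg : f (∑ u ∈ s, μ u • u) ≤ g (∑ u ∈ s, μ u • u) :=
    heq ▸ map_sum_smul_le_of_le (fun a ha => (hκ a ha).le) hκ_sum hle_A
  have hgf : g (∑ a ∈ A, κ a • a) ≤ f (∑ a ∈ A, κ a • a) :=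
    heq ▸ map_sum_smul_le_of_le (fun u hu => (hμ u hu).le) hμ_sum hle_s
  have heq_s := eqOn_of_le_of_map_sum_smul_le hμ hμ_sum hle_s hfg
  have heq_A := eqOn_of_le_of_map_sum_smul_le hκ hκ_sum hle_A hgf
  refine Set.Subset.antisymm (convexHull_mono fun u hu => ?_)
    (convexHull_min (fun a ha => ?_) (convex_convexHull ℝ _))
  · exact (hg.eq_iff u (hsP hu)).1 ((hws u hu).trans (heq_s hu).symm)
  · exact (hf.eq_iff a (hA ha)).1 ((hwA a ha).trans (heq_A ha).symm)

theorem isRegular_of_exists_cutsOut (hT : IsLatticeTriangulation T P) (hP : Convex ℝ P)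
    (h : ∀ s ∈ T.faces, ∃ f : (Fin n → ℝ) →ᵃ[ℝ] ℝ,
      CutsOut f w (P ∩ latticePoints n) (convexHull ℝ (s : Set (Fin n → ℝ)))) :
    IsRegular T P := by
  refine ⟨w, Set.Subset.antisymm ?_ fun F hF => ?_⟩
  · rintro _ ⟨s, hs, rfl⟩
    obtain ⟨f, hf⟩ := h s hs
    exact mem_regularSubdivision.2 ⟨convexHull_nonempty_iff.2 (T.nonempty_of_mem_faces hs), f,
      hf.le, hf.convexHull_eq hT hs⟩
  obtain ⟨hne, g, hg, rfl⟩ := mem_regularSubdivision.1 hF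
  obtain ⟨A, hA⟩ := (hT.finite_inter.subset (Set.sep_subset _ fun a => w a = g a)).exists_finset_coe
  have hAP : (A : Set (Fin n → ℝ)) ⊆ P ∩ latticePoints n := hA.trans_subset (Set.sep_subset _ _)
  have hgA : CutsOut g w (P ∩ latticePoints n) A :=
    ⟨hg, fun a ha => by rw [hA]; exact (and_iff_right ha).symm⟩
  have hA_card : (0 : ℝ) < A.card := by
    have hA_ne : A.Nonempty := by
      rwa [← hA, convexHull_nonempty_iff, Finset.coe_nonempty] at hne
    exact_mod_cast hA_ne.card_pos
  have hκ : (0 : ℝ) < (A.card : ℝ)⁻¹ := inv_pos.2 hA_card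
  have hκ_sum : ∑ _a ∈ A, (A.card : ℝ)⁻¹ = 1 := by
    rw [Finset.sum_const, nsmul_eq_mul, mul_inv_cancel₀ hA_card.ne']
  have hbary : ∑ a ∈ A, (A.card : ℝ)⁻¹ • a ∈ T.space :=
    hT.space_eq ▸ hP.sum_mem (fun _ _ => hκ.le) hκ_sum fun a ha => (hAP ha).1
  obtain ⟨s, hs, μ, hμ, hμ_sum, hμ_smul⟩ := exists_face_pos_weights hbary
  obtain ⟨f, hf⟩ := h s hs
  exact ⟨s, hs, hA ▸ hf.convexHull_eq_of_sum_smul_eq hT hs hgA hAP hμ hμ_sum (fun _ _ => hκ) hκ_sum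
    hμ_smul⟩

theorem exists_cutsOut_of_simplices_eq (hT : IsLatticeTriangulation T P)
    (hw : simplices T = regularSubdivision P w) {σ : Finset (Fin n → ℝ)} (hσ : σ ∈ T.faces) :
    ∃ f : (Fin n → ℝ) →ᵃ[ℝ] ℝ, CutsOut f w T.vertices σ := by
  have hmem : convexHull ℝ (σ : Set (Fin n → ℝ)) ∈ regularSubdivision P w := hw ▸ ⟨σ, hσ, rfl⟩
  obtain ⟨-, f, hle, heq⟩ := mem_regularSubdivision.1 hmem
  refine ⟨f, fun p hp => hle p (hT.vertices_subset_inter hp), fun p hp => ⟨fun h => ?_, fun h =>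
    (coe_subset_of_convexHull_eq (T.indep hσ) heq.symm h).2⟩⟩
  rw [Finset.mem_coe, ← SimplicialComplex.vertex_mem_convexHull_iff hp hσ, heq]
  exact subset_convexHull ℝ _ ⟨hT.vertices_subset_inter hp, h⟩

end RegularityCriterion

section CellWeight

/-- The piecewise linear function interpolating the squares of the integers. -/
noncomputable def interpSq (t : ℝ) : ℝ := t ^ 2 + Int.fract t * (1 - Int.fract t)

/- `(k + l) * t - k * l = t ^ 2 - (t - k) * (t - l)` is the chord of the square function over
`[k, l]`. -/
theorem chord_lt_interpSq {k l t : ℝ} (hkl : k ≤ l) (ht : t ∉ Set.Icc k l) :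
    (k + l) * t - k * l < interpSq t := by
  have hfract : 0 ≤ Int.fract t * (1 - Int.fract t) :=
    mul_nonneg (Int.fract_nonneg t) (sub_nonneg.2 (Int.fract_lt_one t).le)
  have hpos : 0 < (t - k) * (t - l) := by
    rw [Set.mem_Icc, not_and_or, not_le, not_le] at ht
    rcases ht with ht | ht
    · exact mul_pos_of_neg_of_neg (by linarith) (by linarith)
    · exact mul_pos (by linarith) (by linarith)
  rw [interpSq]
  linarith

theorem interpSq_eq_chord {k l : ℤ} (hlk : l ≤ k + 1) {t : ℝ} (ht : t ∈ Set.Icc (k : ℝ) l) :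
    interpSq t = (k + l) * t - k * l := by
  rw [interpSq]
  rcases ht.2.eq_or_lt with rfl | htl
  · rw [Int.fract_intCast]
    ring
  · have hfloor : ⌊t⌋ = k := Int.floor_eq_iff.2 ⟨ht.1, htl.trans_le (by exact_mod_cast hlk)⟩
    have hl : l = k + 1 := hlk.antisymm (by exact_mod_cast ht.1.trans_lt htl)
    rw [Int.fract, hfloor, hl]
    push_cast
    ring

theorem chord_le_interpSq (t₀ t : ℝ) :
    ((⌊t₀⌋ : ℝ) + ⌈t₀⌉) * t - ⌊t₀⌋ * ⌈t₀⌉ ≤ interpSq t := by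
  by_cases ht : t ∈ Set.Icc (⌊t₀⌋ : ℝ) ⌈t₀⌉
  · exact (interpSq_eq_chord (Int.ceil_le_floor_add_one t₀) ht).ge
  · exact (chord_lt_interpSq (by exact_mod_cast Int.floor_le_ceil t₀) ht).le

theorem chord_eq_interpSq_iff (t₀ t : ℝ) :
    ((⌊t₀⌋ : ℝ) + ⌈t₀⌉) * t - ⌊t₀⌋ * ⌈t₀⌉ = interpSq t ↔ t ∈ Set.Icc (⌊t₀⌋ : ℝ) ⌈t₀⌉ := by
  refine ⟨fun h => ?_, fun ht => (interpSq_eq_chord (Int.ceil_le_floor_add_one t₀) ht).symm⟩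
  by_contra ht
  exact (chord_lt_interpSq (by exact_mod_cast Int.floor_le_ceil t₀) ht).ne h

variable {V : Type*} [PartialOrder V] [Fintype V]

noncomputable instance : Fintype (UpperSet V) :=
  Fintype.ofInjective ((↑) : UpperSet V → Set V) SetLike.coe_injective

/-- A convex function whose domains of linearity are the cells. -/
noncomputable def cellWeight (x : V → ℝ) : ℝ :=
  ∑ p : UpperSet V × UpperSet V, interpSq (upperDiff p.1 p.2 x)

theorem mem_cell_iff_forall_mem_Icc {x y : V → ℝ} : y ∈ cell x ↔ ∀ p : UpperSet V × UpperSet V,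
    upperDiff p.1 p.2 y ∈ Set.Icc (⌊upperDiff p.1 p.2 x⌋ : ℝ) ⌈upperDiff p.1 p.2 x⌉ :=
  ⟨fun h p => ⟨floor_le_upperDiff_of_mem_cell h p.1 p.2, h p.1 p.2⟩, fun h U W => (h (U, W)).2⟩

theorem exists_cutsOut_cell (x : V → ℝ) :
    ∃ f : (V → ℝ) →ᵃ[ℝ] ℝ, CutsOut f cellWeight Set.univ (cell x) := by
  let k : UpperSet V × UpperSet V → ℝ := fun p => ⌊upperDiff p.1 p.2 x⌋
  let l : UpperSet V × UpperSet V → ℝ := fun p => ⌈upperDiff p.1 p.2 x⌉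
  let f : (V → ℝ) →ᵃ[ℝ] ℝ := (∑ p, (k p + l p) • upperDiff p.1 p.2).toAffineMap -
    AffineMap.const ℝ _ (∑ p, k p * l p)
  have hf : ∀ y, f y = ∑ p, ((k p + l p) * upperDiff p.1 p.2 y - k p * l p) := fun y => by
    simp [f, Finset.sum_sub_distrib]
  have hle : ∀ y, ∀ p ∈ Finset.univ, (k p + l p) * upperDiff p.1 p.2 y - k p * l p ≤
      interpSq (upperDiff p.1 p.2 y) := fun y p _ => chord_le_interpSq _ _
  refine ⟨f, fun y _ => ?_, fun y _ => ?_⟩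
  · rw [hf]
    exact Finset.sum_le_sum (hle y)
  · rw [eq_comm, hf, cellWeight, Finset.sum_eq_sum_iff_of_le (hle y), mem_cell_iff_forall_mem_Icc]
    simp only [Finset.mem_univ, true_imp_iff, k, l, chord_eq_interpSq_iff]

end CellWeight

section RegularRefinement

open Filter Topology

theorem eventually_forall_add_mul_nonneg {ι : Type*} [Finite ι] {a b : ι → ℝ}
    (ha : ∀ i, 0 ≤ a i) (hab : ∀ i, a i = 0 → b i = 0) :
    ∀ᶠ ε in 𝓝[>] (0 : ℝ), ∀ i, 0 ≤ a i + ε * b i := by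
  refine eventually_all.2 fun i => ?_
  rcases (ha i).eq_or_lt with hi | hi
  · simp [← hi, hab i hi.symm]
  · have hcont : Tendsto (fun ε => a i + ε * b i) (𝓝 0) (𝓝 (a i)) := by
      simpa using (show Continuous fun ε => a i + ε * b i by fun_prop).tendsto 0
    exact ((hcont.eventually_const_lt hi).mono fun _ => le_of_lt).filter_mono nhdsWithin_le_nhds

variable {E : Type*} [AddCommGroup E] [Module ℝ E] {T : SimplicialComplex ℝ E}
  {V : Type*} [LinearOrder V] [Fintype V] {e : V ≃ T.vertices} {c : ℕ}
  {σ : Finset E} {x : V → ℝ}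

theorem exists_cutsOut_cell_of_sum_eq (c : ℕ) [NeZero c] (x : V → ℝ) :
    ∃ b : V → ℝ, ∀ y, ∑ v, y v = (c : ℝ) →
      ∑ v, y v * b v ≤ cellWeight y ∧ (cellWeight y = ∑ v, y v * b v ↔ y ∈ cell x) := by
  obtain ⟨f, hf⟩ := exists_cutsOut_cell x
  refine ⟨fun v => f.linear (Pi.single v 1) + f 0 / c, fun y hy => ?_⟩
  have hfy : ∑ v, y v * (f.linear (Pi.single v 1) + f 0 / c) = f y := by
    simp only [mul_add, Finset.sum_add_distrib]
    rw [← map_eq_sum_single, ← Finset.sum_mul, hy, mul_div_cancel₀ _ (NeZero.ne _)]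
    exact (congrFun f.decomp y).symm
  rw [hfy]
  exact ⟨hf.le y trivial, hf.eq_iff y trivial⟩

/-- The weights of the refinement: the weights `w` of `T`, extended affinely over each dilated
face, perturbed by a small multiple of `cellWeight`. -/
noncomputable def refinedWeight (e : V ≃ T.vertices) (w : E → ℝ) (ε : ℝ) (x : V → ℝ) : ℝ :=
  ∑ v, x v * w (e v) + ε * cellWeight x

theorem exists_cutsOut_refinedWeight {k : E →ᵃ[ℝ] ℝ} {w : E → ℝ} {b : V → ℝ} {ε : ℝ} (hε : 0 < ε)
    (hb : ∀ y, ∑ v, y v = (c : ℝ) →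
      ∑ v, y v * b v ≤ cellWeight y ∧ (cellWeight y = ∑ v, y v * b v ↔ y ∈ cell x))
    (hk : ∀ v, k (e v) ≤ w (e v) + ε * b v)
    (hkσ : ∀ v, (e v : E) ∈ σ → k (e v) = w (e v) + ε * b v) (hx : x ∈ dilatedFace e c σ) :
    ∃ g : E →ᵃ[ℝ] ℝ, CutsOut (g.comp (realize e).toAffineMap) (refinedWeight e w ε)
      (dilatedComplex e c) (cell x) := by
  let g : E →ᵃ[ℝ] ℝ := k.linear.toAffineMap + AffineMap.const ℝ E (c * k 0)
  have hgap : ∀ y, ∑ v, y v = (c : ℝ) → refinedWeight e w ε y - g (realize e y) =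
      ∑ v, y v * (w (e v) + ε * b v - k (e v)) + ε * (cellWeight y - ∑ v, y v * b v) := by
    intro y hy
    have hg : g (realize e y) = ∑ v, y v * k (e v) := by
      rw [← linear_sum_smul_add k, hy, ← realize_apply]
      rfl
    rw [hg, refinedWeight, mul_sub, Finset.mul_sum, add_sub_left_comm]
    simp only [mul_sub, mul_add, Finset.sum_sub_distrib, Finset.sum_add_distrib, mul_left_comm ε]
    ring
  refine ⟨g, ?_⟩
  suffices h : ∀ y ∈ dilatedComplex e c, g (realize e y) ≤ refinedWeight e w ε y ∧
      (refinedWeight e w ε y = g (realize e y) ↔ y ∈ cell x) from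
    ⟨fun y hy => (h y hy).1, fun y hy => (h y hy).2⟩
  intro y hy
  obtain ⟨τ, -, hyτ⟩ := mem_dilatedComplex.1 hy
  obtain ⟨hb_le, hb_iff⟩ := hb y hyτ.2.1
  have hvertices : 0 ≤ ∑ v, y v * (w (e v) + ε * b v - k (e v)) :=
    Finset.sum_nonneg fun v _ => mul_nonneg (hyτ.1 v) (sub_nonneg.2 (hk v))
  have hcell : 0 ≤ ε * (cellWeight y - ∑ v, y v * b v) := mul_nonneg hε.le (sub_nonneg.2 hb_le)
  rw [← sub_nonneg, ← sub_eq_zero, hgap y hyτ.2.1, add_eq_zero_iff_of_nonneg hvertices hcell,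
    mul_eq_zero, or_iff_right hε.ne', sub_eq_zero, hb_iff]
  refine ⟨add_nonneg hvertices hcell, and_iff_right_of_imp fun hyx => ?_⟩
  refine Finset.sum_eq_zero fun v _ => ?_
  by_cases hv : (e v : E) ∈ σ
  · rw [hkσ v hv, sub_self, mul_zero]
  · rw [(cell_subset_dilatedFace hx hyx).2.2 v hv, zero_mul]

variable [NeZero c]

theorem eventually_exists_cutsOut {f : E →ᵃ[ℝ] ℝ} {w : E → ℝ} (hf : CutsOut f w T.vertices σ)
    (hσ : σ ∈ T.faces) (hx : x ∈ dilatedFace e c σ) :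
    ∀ᶠ ε in 𝓝[>] (0 : ℝ), ∃ g : E →ᵃ[ℝ] ℝ,
      CutsOut (g.comp (realize e).toAffineMap) (refinedWeight e w ε) (dilatedComplex e c)
        (cell x) := by
  obtain ⟨b, hb⟩ := exists_cutsOut_cell_of_sum_eq c x
  obtain ⟨h, hh⟩ := exists_affineMap_eqOn (T.indep hσ)
    (Function.extend (fun v => (e v : E)) b 0)
  have hhb : ∀ v, (e v : E) ∈ σ → h (e v) = b v := fun v hv =>
    (hh hv).trans ((Subtype.val_injective.comp e.injective).extend_apply b 0 v)
  have hnonneg : ∀ᶠ ε in 𝓝[>] (0 : ℝ), ∀ v, 0 ≤ w (e v) - f (e v) + ε * (b v - h (e v)) :=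
    eventually_forall_add_mul_nonneg (fun v => sub_nonneg.2 (hf.le _ (e v).2)) fun v hv =>
      sub_eq_zero.2 (hhb v ((hf.eq_iff _ (e v).2).1 (sub_eq_zero.1 hv))).symm
  filter_upwards [hnonneg, self_mem_nhdsWithin] with ε hε_nonneg hε
  refine exists_cutsOut_refinedWeight (k := f + ε • h) hε hb (fun v => ?_) (fun v hv => ?_) hx
  · have := hε_nonneg v
    simp only [AffineMap.coe_add, AffineMap.coe_smul, Pi.add_apply, Pi.smul_apply, smul_eq_mul]
    linarith
  · simp [hhb v hv, (hf.eq_iff _ (e v).2).2 hv]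

theorem isRegular_refinedComplex {n : ℕ} {T : SimplicialComplex ℝ (Fin n → ℝ)}
    {e : V ≃ T.vertices} {P : Set (Fin n → ℝ)} (hP : Convex ℝ P)
    (hT : IsLatticeTriangulation T P) (hreg : IsRegular T P) :
    IsRegular (refinedComplex e c) ((c : ℝ) • P) := by
  obtain ⟨w, hw⟩ := hreg
  have hexists : ∀ᶠ ε in 𝓝[>] (0 : ℝ), ∀ t ∈ (refinedComplex e c).faces,
      ∃ g : (Fin n → ℝ) →ᵃ[ℝ] ℝ,
        CutsOut g (refinedWeight e w ε ∘ Function.invFunOn (realize e) (dilatedComplex e c))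
          ((c : ℝ) • P) (convexHull ℝ (t : Set (Fin n → ℝ))) := by
    refine (eventually_all_finite finite_faces_refinedComplex).2 ?_
    rintro t ⟨x, hx, ht⟩
    obtain ⟨σ, hσ, hxσ⟩ := mem_dilatedComplex.1 hx
    obtain ⟨f, hf⟩ := exists_cutsOut_of_simplices_eq hT hw hσ
    filter_upwards [eventually_exists_cutsOut hf hσ hxσ] with ε ⟨g, hg⟩
    refine ⟨g, ?_⟩
    rw [← hT.space_eq, ← image_realize_dilatedComplex (e := e), convexHull_eq_image_cell ht]
    exact hg.invFunOn injOn_realize_dilatedComplex (cell_subset_dilatedComplex hx)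
  obtain ⟨ε, hε⟩ := hexists.exists
  refine isRegular_of_exists_cutsOut
    (w := refinedWeight e w ε ∘ Function.invFunOn (realize e) (dilatedComplex e c))
    (isLatticeTriangulation_refinedComplex hT) (hP.smul _) fun t ht => ?_
  obtain ⟨g, hg⟩ := hε t ht
  exact ⟨g, hg.mono Set.inter_subset_left⟩

end RegularRefinement

section CanonicalRefinement

variable {n : ℕ} {T : SimplicialComplex ℝ (Fin n → ℝ)} {c : ℕ}

theorem exists_strictMono_range_eq {V : Type*} [LinearOrder V] [Finite V] (e : V ≃ T.vertices)
    {σ : Finset (Fin n → ℝ)} (hσ : σ ∈ T.faces) :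
    ∃ (d : ℕ) (a : Fin (d + 1) → V), StrictMono a ∧
      (σ : Set (Fin n → ℝ)) = Set.range fun i => (e (a i) : Fin n → ℝ) := by
  classical
  have := Fintype.ofFinite V
  let A : Finset V := {v | (e v : Fin n → ℝ) ∈ σ}
  have hσA : (σ : Set (Fin n → ℝ)) = (fun v => (e v : Fin n → ℝ)) '' A := by
    refine Set.Subset.antisymm (fun p hp => ?_) ?_
    · obtain ⟨v, rfl⟩ := exists_label e hσ hp
      exact ⟨v, by simpa [A] using hp, rfl⟩
    · rintro _ ⟨v, hv, rfl⟩
      simpa [A] using hv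
  have hA : A.Nonempty := by
    rw [← Finset.coe_nonempty, ← Set.image_nonempty (f := fun v => (e v : Fin n → ℝ)), ← hσA]
    exact T.nonempty_of_mem_faces hσ
  have hcard : A.card = A.card - 1 + 1 := (Nat.sub_add_cancel hA.card_pos).symm
  refine ⟨A.card - 1, A.orderEmbOfFin hcard, (A.orderEmbOfFin hcard).strictMono, ?_⟩
  rw [hσA, ← Finset.range_orderEmbOfFin A hcard, ← Set.range_comp]
  rfl

theorem IsLatticeTriangulation.finite_vertices {P : Set (Fin n → ℝ)}
    (hT : IsLatticeTriangulation T P) : T.vertices.Finite := by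
  rw [SimplicialComplex.vertices_eq]
  exact hT.finite.biUnion fun s _ => s.finite_toSet

variable [LinearOrder T.vertices] [Fintype T.vertices] [NeZero c]

theorem IsOrderedFace.setOf_simplices_subset_eq {d : ℕ} {a : Fin (d + 1) → T.vertices}
    (ha : IsOrderedFace T ‹_› a) :
    {C | C ∈ simplices (refinedComplex (Equiv.refl T.vertices) c) ∧
      C ⊆ (c : ℝ) • convexHull ℝ (Set.range fun i => (a i : Fin n → ℝ))} =
      canonicalTriangulation c fun i => (a i : Fin n → ℝ) := by
  obtain ⟨ha_mono, σ, hσ, hσa⟩ := ha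
  rw [← hσa, simplices_refinedComplex_subset hσ]
  exact (canonicalTriangulation_eq_image_cell (e := Equiv.refl T.vertices)
    (fun i j => ha_mono i j) hσa).symm

theorem simplices_refinedComplex_eq_canonicalRefinement :
    simplices (refinedComplex (Equiv.refl T.vertices) c) = canonicalRefinement T ‹_› c := by
  ext C
  constructor
  · rw [simplices_refinedComplex]
    rintro ⟨x, hx, rfl⟩
    obtain ⟨σ, hσ, hxσ⟩ := mem_dilatedComplex.1 hx
    obtain ⟨d, a, ha, hσa⟩ := exists_strictMono_range_eq (Equiv.refl T.vertices) hσ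
    refine ⟨d, a, ⟨fun i j h => ha h, σ, hσ, hσa⟩, ?_⟩
    exact canonicalTriangulation_eq_image_cell (c := c) ha hσa ▸ ⟨x, hxσ, rfl⟩
  · rintro ⟨d, a, ha, hC⟩
    rw [← ha.setOf_simplices_subset_eq] at hC
    exact hC.1

end CanonicalRefinement

end LatticeTriang

theorem mainTheorem4_general {n : ℕ} (P : Set (Fin n → ℝ)) (c : ℕ) (hc : 0 < c) :
    (∀ (T : SimplicialComplex ℝ (Fin n → ℝ)) (ord : LinearOrder T.vertices),
      IsLatticeTriangulation T P →
        ∃ T' : SimplicialComplex ℝ (Fin n → ℝ),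
          simplices T' = canonicalRefinement T ord c ∧
          IsLatticeTriangulation T' ((c : ℝ) • P) ∧
          (∀ (d : ℕ) (a : Fin (d + 1) → T.vertices), IsOrderedFace T ord a →
            {C | C ∈ simplices T' ∧
              C ⊆ (c : ℝ) • convexHull ℝ (Set.range fun i => (a i : Fin n → ℝ))} =
              canonicalTriangulation c (fun i => (a i : Fin n → ℝ))) ∧
          (IsUnimodular T → IsUnimodular T') ∧
          (Convex ℝ P → IsRegular T P → IsRegular T' ((c : ℝ) • P)) ∧
          (IsFlag T → IsFlag T')) ∧
    (Convex ℝ P → (∃ T : SimplicialComplex ℝ (Fin n → ℝ), IsQuadraticTriangulation T P) →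
      ∃ T' : SimplicialComplex ℝ (Fin n → ℝ), IsQuadraticTriangulation T' ((c : ℝ) • P)) := by
  have : NeZero c := ⟨hc.ne'⟩
  refine (and_iff_left_of_imp fun hrefine hP => ?_).2 fun T ord hT => ?_
  · rintro ⟨T, hT⟩
    obtain ⟨T', -, htri, -, huni, hreg, hflag⟩ := hrefine T
      (@IsWellOrder.linearOrder _ WellOrderingRel _) hT.triangulation
    exact ⟨T', htri, hreg hP hT.regular, huni hT.unimodular, hflag hT.flag⟩
  · have : Fintype T.vertices := hT.finite_vertices.fintype
    exact ⟨refinedComplex (Equiv.refl T.vertices) c,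
      simplices_refinedComplex_eq_canonicalRefinement,
      isLatticeTriangulation_refinedComplex hT, fun d a ha => ha.setOf_simplices_subset_eq,
      isUnimodular_refinedComplex hT, fun hP => isRegular_refinedComplex hP hT,
      isFlag_refinedComplex⟩

theorem mainTheorem4 {n : ℕ} (P : Set (Fin n → ℝ)) (hP : IsLatticePolytope P)
    (c : ℕ) (hc : 0 < c) :
    (∀ (T : SimplicialComplex ℝ (Fin n → ℝ)) (ord : LinearOrder T.vertices),
      IsLatticeTriangulation T P →
        ∃ T' : SimplicialComplex ℝ (Fin n → ℝ),
          simplices T' = canonicalRefinement T ord c ∧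
          IsLatticeTriangulation T' ((c : ℝ) • P) ∧
          (∀ (d : ℕ) (a : Fin (d + 1) → T.vertices), IsOrderedFace T ord a →
            {C | C ∈ simplices T' ∧
              C ⊆ (c : ℝ) • convexHull ℝ (Set.range fun i => (a i : Fin n → ℝ))} =
              canonicalTriangulation c (fun i => (a i : Fin n → ℝ))) ∧
          (IsUnimodular T → IsUnimodular T') ∧
          (IsRegular T P → IsRegular T' ((c : ℝ) • P)) ∧
          (IsFlag T → IsFlag T')) ∧
    ((∃ T : SimplicialComplex ℝ (Fin n → ℝ), IsQuadraticTriangulation T P) →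
      ∃ T' : SimplicialComplex ℝ (Fin n → ℝ), IsQuadraticTriangulation T' ((c : ℝ) • P)) := by
  have hconvex : Convex ℝ P := by
    obtain ⟨A, -, rfl⟩ := hP
    exact convex_convexHull ℝ _
  simpa only [hconvex, true_imp_iff] using mainTheorem4_general P c hc
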